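/- **Corollary 1.2.** Let $(M^4,g)$ be an oriented and time-oriented spacetime of signature $(-,+,+,+)$, and let $\Omega\subset M$ be a compact embedded spacelike 3-dimensional domain with smooth boundary $S=\partial\Omega$ (a closed surface) and outward unit normal $\nu$ (tangent to $\Omega$). Let $N$ be a future-directed timelike vector field on $S$ which is orthogonal to $\Omega$, extended smoothly, in an arbitrary way, to an open neighbourhood $U$ of $S$. Orient $S$ so that $N$, $\nu$ and the orientation of $S$ form the orientation of $M$. Let $(\overline M,\overline g)$ be the Minkowski spacetime with coordinates $(T,X,Y,Z)$, $\overline g=-dT^2+dX^2+dY^2+dZ^2$, oriented by $dT\wedge dX\wedge dY\wedge dZ$ and time-oriented by $\partial/\partial T$. A *reference* is a smooth embedding $\varphi:U\to\overline M$ preserving the orientation and the time orientation; it is a *4D isometric matching reference* if $\varphi^*\overline g=g$ at every point of $S$. The *Chen–Nester–Tung (CNT) quasi-local energy* is, with $\kappa=8\pi$, $$E(S,N,\varphi)=\frac1{2\kappa}\int_S\iota^*\Big[(\omega^a{}_b-\overline\omega^a{}_b)\wedge i_N\eta_a{}^b+\overline D_bN^a\,(\eta_a{}^b-\overline\eta_a{}^b)\Big],\qquad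 \eta_a{}^b=\tfrac12\sqrt{-\det g}\;g^{b\beta}\epsilon_{a\beta\mu\nu}\,dx^\mu\wedge dx^\nu,$$ where $\iota:S\to M$ is the inclusion, $\omega^a{}_b$ and $\overline\omega^a{}_b$ are the Levi-Civita connection forms of $g$ and $\varphi^*\overline g$, and $\overline D$, $\overline\eta_a{}^b$ are the covariant derivative and the 2-forms belonging to $\varphi^*\overline g$. Let $\varphi$ be any 4D isometric matching reference such that 1. $\varphi_*N=\partial/\partial T$ on $S$; 2. $\varphi(S)\subset\mathbb R^3$, where $\mathbb R^3$ is identified with a slice $\{T=c\}$, $c$ a constant (for instance $c=0$); and such that $\varphi_*\nu$ points, along $\varphi(S)$, out of the bounded region of $\mathbb R^3$ which $\varphi(S)$ encloses. Then $$E(S,N,\varphi)=\mathfrak m_{\mathrm{BY}}(\Omega)=\frac1{8\pi}\int_S(k_0-k)\,dV_S,$$ where $k$ is the mean curvature of $S$ in $\Omega$ with respect to $\nu$ and $k_0$ is the mean curvature of $\varphi(S)$ in $\mathbb R^3$ with respect to its outward unit normal (normalized so that a round sphere of radius $r$ in $\mathbb R^3$ has mean curvature $2/r$). -/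

import Mathlib

open scoped Manifold ContDiff
open Topology

attribute [instance] chartedSpaceSelf

noncomputable section

/-! ## Coordinate calculus on manifolds

In Mathlib the tangent space `TangentSpace I p` is by definition the model space `E`, and a
tangent vector at `p` is identified with its components in the preferred chart at `p`. In the
definitions below tangent vectors are therefore written as elements of `E`, and all coordinate
expressions at `p` are evaluated in the preferred chart at `p`. -/

/-- Euclidean space `ℝⁿ`. -/
abbrev Eu (n : ℕ) : Type := EuclideanSpace ℝ (Fin n)

/-- The standard basis of `ℝⁿ`. -/
def stdVec {n : ℕ} (i : Fin n) : Eu n := EuclideanSpace.single i (1 : ℝ)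

section Generic

variable {E H : Type*} [NormedAddCommGroup E] [NormedSpace ℝ E] [TopologicalSpace H]
  {Q : Type*} [TopologicalSpace Q] [ChartedSpace H Q]

/-- Fields of bilinear forms on the tangent spaces of a manifold `Q` with model space `E`. -/
abbrev BilinField (E : Type*) [NormedAddCommGroup E] [NormedSpace ℝ E] (Q : Type*) : Type _ :=
  Q → E →L[ℝ] E →L[ℝ] ℝ

/-- The derivative `df_p : T_p P → T_{f p} Q` of a map between manifolds. -/
def dmap {E' H' : Type*} [NormedAddCommGroup E'] [NormedSpace ℝ E'] [TopologicalSpace H']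
    {P : Type*} [TopologicalSpace P] [ChartedSpace H' P]
    (J : ModelWithCorners ℝ E' H') (I : ModelWithCorners ℝ E H) (f : P → Q) (p : P) :
    E' →L[ℝ] E :=
  mfderiv J I f p

/-- The tangent map at the point `x` of the parametrization inverse to the preferred chart
at `p`; the images of a basis of `E` are the coordinate vector fields of this chart. -/
def chartFrame (I : ModelWithCorners ℝ E H) (p : Q) (x : E) :
    E →L[ℝ] E :=
  mfderivWithin 𝓘(ℝ, E) I (extChartAt I p).symm (Set.range I) x

/-- The coordinate representation of a field of bilinear forms in the preferred chart at `p`. -/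
def coordBilin (I : ModelWithCorners ℝ E H) (B : BilinField E Q) (p : Q) (x : E) :
    E →L[ℝ] E →L[ℝ] ℝ :=
  (B ((extChartAt I p).symm x)).bilinearComp (chartFrame I p x) (chartFrame I p x)

/-- `D_u (B(v, w))` at `p`, in the preferred chart at `p` (with `v`, `w` constant in the chart). -/
def coordDeriv (I : ModelWithCorners ℝ E H) (B : BilinField E Q) (p : Q) (u v w : E) : ℝ :=
  fderivWithin ℝ (fun x => coordBilin I B p x v w) (Set.range I) (extChartAt I p p) u

/-- Christoffel symbols of the first kind of the metric `B` at `p`, in the preferred chart at `p`: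
`[uv, w] = ½ (D_u B(v,w) + D_v B(u,w) - D_w B(u,v))`, which is `B(∇_u v, w)` for the Levi-Civita
connection `∇` of `B` and vector fields `u`, `v` that are constant in the chart. -/
def christoffelFirst (I : ModelWithCorners ℝ E H) (B : BilinField E Q) (p : Q) (u v w : E) : ℝ :=
  (1 / 2) * (coordDeriv I B p u v w + coordDeriv I B p v u w - coordDeriv I B p w u v)

/-- Pullback of a field of bilinear forms. -/
def pullbackBilin {E' H' : Type*} [NormedAddCommGroup E'] [NormedSpace ℝ E'] [TopologicalSpace H']
    {P : Type*} [TopologicalSpace P] [ChartedSpace H' P]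
    (J : ModelWithCorners ℝ E' H') (I : ModelWithCorners ℝ E H) (f : P → Q)
    (B : BilinField E Q) : BilinField E' P :=
  fun p => (B (f p)).bilinearComp (dmap J I f p) (dmap J I f p)

/-- Smooth embeddings: smooth immersions that are topological embeddings. -/
structure IsSmoothEmb {E' H' : Type*} [NormedAddCommGroup E'] [NormedSpace ℝ E']
    [TopologicalSpace H'] {P : Type*} [TopologicalSpace P] [ChartedSpace H' P]
    (J : ModelWithCorners ℝ E' H') (I : ModelWithCorners ℝ E H) (f : P → Q) : Prop where
  contMDiff : ContMDiff J I ∞ f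
  injective_dmap : ∀ p, Function.Injective (dmap J I f p)
  isEmbedding : IsEmbedding f

end Generic

/-! ## Orientations, volume forms, integration of forms over closed surfaces -/

/-- An orientation of an `n`-manifold, given by a nowhere vanishing continuous `n`-form; a basis
of a tangent space is positive when the form is positive on it. -/
structure OrientationForm (n : ℕ) (Q : Type*) [TopologicalSpace Q] [ChartedSpace (Eu n) Q] where
  form : Q → Eu n [⋀^Fin n]→ₗ[ℝ] ℝ
  ne_zero : ∀ p, form p ≠ 0
  continuousOn : ∀ p : Q, ContinuousOn
    (fun x : Eu n => form ((extChartAt (𝓡 n) p).symm x)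
      (fun i => chartFrame (𝓡 n) p x (stdVec i))) (extChartAt (𝓡 n) p).target

section Oriented

variable {n : ℕ} {Q : Type*} [TopologicalSpace Q] [ChartedSpace (Eu n) Q]

/-- The matrix of components `g_{ab}` at `p`. -/
def gram (B : BilinField (Eu n) Q) (p : Q) : Matrix (Fin n) (Fin n) ℝ :=
  Matrix.of fun a b => B p (stdVec a) (stdVec b)

/-- The oriented volume form `√|det g| dx¹ ∧ … ∧ dxⁿ` of the metric `B` at `p`
(with the opposite sign if the coordinates are negatively oriented). -/
def volForm (o : OrientationForm n Q) (B : BilinField (Eu n) Q) (p : Q) (v : Fin n → Eu n) : ℝ :=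
  (SignType.sign (o.form p stdVec) : ℝ) * √|(gram B p).det| *
    (Matrix.of fun i k => v i k).det

/-- The connection form `ω^a_b` of the Levi-Civita connection of `B` in the coordinate frame,
at `p`, evaluated on `v`: `ω^a_b(v) = Γ^a_{cb} v^c`. -/
def connForm (B : BilinField (Eu n) Q) (p : Q) (a b : Fin n) (v : Eu n) : ℝ :=
  ∑ d, (gram B p)⁻¹ a d * christoffelFirst (𝓡 n) B p v (stdVec b) (stdVec d)

/-- Components of the vector field `N` in the preferred chart at `p`. -/
def coordVec (N : Q → Eu n) (p : Q) (x : Eu n) : Eu n :=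
  dmap (𝓡 n) 𝓘(ℝ, Eu n) (extChartAt (𝓡 n) p) ((extChartAt (𝓡 n) p).symm x)
    (N ((extChartAt (𝓡 n) p).symm x))

/-- The component `D_b N^a = ∂_b N^a + Γ^a_{bc} N^c` at `p` of the covariant derivative of `N`
with respect to the Levi-Civita connection of `B`. -/
def covDerivComp (B : BilinField (Eu n) Q) (N : Q → Eu n) (p : Q)
    (b a : Fin n) : ℝ :=
  (fderiv ℝ (coordVec N p) (extChartAt (𝓡 n) p p) (stdVec b)) a +
    ∑ c, connForm B p a c (stdVec b) * N p c

end Oriented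

section Surface

variable {S : Type*} [TopologicalSpace S] [ChartedSpace (Eu 2) S]

/-- The integral over an oriented closed surface `S` of the 2-form `α` (the 2-form being given by
its values `α s u v`), by means of a partition of unity subordinate to the preferred charts. -/
def formIntegral [IsManifold (𝓡 2) ∞ S] [CompactSpace S] [T2Space S]
    (o : OrientationForm 2 S) (α : S → Eu 2 → Eu 2 → ℝ) : ℝ :=
  let ρ := Classical.choose (SmoothPartitionOfUnity.exists_isSubordinate_chartAt_source (𝓡 2) S)
  ∑ᶠ i : S, ∫ x in (extChartAt (𝓡 2) i).target,
    (SignType.sign (o.form ((extChartAt (𝓡 2) i).symm x)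
        (fun k => chartFrame (𝓡 2) i x (stdVec k))) : ℝ) *
      ρ i ((extChartAt (𝓡 2) i).symm x) *
      α ((extChartAt (𝓡 2) i).symm x)
        (chartFrame (𝓡 2) i x (stdVec 0)) (chartFrame (𝓡 2) i x (stdVec 1))

/-- The integral `∫_S f dV_S` with respect to the area form of the Riemannian metric `h`. -/
def areaIntegral [IsManifold (𝓡 2) ∞ S] [CompactSpace S] [T2Space S]
    (o : OrientationForm 2 S) (h : BilinField (Eu 2) S) (f : S → ℝ) : ℝ :=
  formIntegral o fun s u v => f s * volForm o h s ![u, v]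

/-- The mean curvature at `s`, with respect to the unit normal field `n`, of a surface
`f : S → Q` immersed in the Riemannian 3-manifold `(Q, B)`: the trace of
`(u, v) ↦ -B(∇_u f_* v, n)`, with `∇` the Levi-Civita connection of `B`. With this sign a round
sphere of radius `r` in `ℝ³` has mean curvature `2 / r` with respect to the outward normal. -/
def meanCurvature {E H : Type*} [NormedAddCommGroup E] [NormedSpace ℝ E] [TopologicalSpace H]
    {Q : Type*} [TopologicalSpace Q] [ChartedSpace H Q] (I : ModelWithCorners ℝ E H)
    (B : BilinField E Q) (f : S → Q) (n : S → E) (s : S) : ℝ :=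
  let F : Eu 2 → E := extChartAt I (f s) ∘ f ∘ (extChartAt (𝓡 2) s).symm
  let x : Eu 2 := extChartAt (𝓡 2) s s
  let d : Fin 2 → E := fun i => fderiv ℝ F x (stdVec i)
  let h : Matrix (Fin 2) (Fin 2) ℝ := Matrix.of fun i k => B (f s) (d i) (d k)
  ∑ i, ∑ k, -(h⁻¹ i k * (B (f s) (fderiv ℝ (fderiv ℝ F) x (stdVec i) (stdVec k)) (n s) +
      christoffelFirst I B (f s) (d i) (d k) (n s)))

end Surface

/-! ## Spacetimes -/

/-- A spacetime structure on a 4-manifold: a smooth Lorentzian metric of signature `(-,+,+,+)`,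
an orientation, and a time orientation (given by a continuous timelike vector field). -/
structure Spacetime (M : Type*) [TopologicalSpace M] [ChartedSpace (Eu 4) M]
    [IsManifold (𝓡 4) ∞ M] where
  g : BilinField (Eu 4) M
  symm : ∀ (p : M) (u v : Eu 4), g p u v = g p v u
  lorentz : ∀ p : M, ∃ e : Module.Basis (Fin 4) ℝ (Eu 4),
    ∀ i k, g p (e i) (e k) = Matrix.diagonal ![(-1 : ℝ), 1, 1, 1] i k
  smooth : ∀ p : M, ContDiffOn ℝ ∞ (coordBilin (𝓡 4) g p) (extChartAt (𝓡 4) p).target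
  orient : OrientationForm 4 M
  time : M → Eu 4
  time_timelike : ∀ p, g p (time p) (time p) < 0
  time_continuous : Continuous (fun p => (⟨p, time p⟩ : TangentBundle (𝓡 4) M))

namespace Spacetime

variable {M : Type*} [TopologicalSpace M] [ChartedSpace (Eu 4) M] [IsManifold (𝓡 4) ∞ M]

/-- Future-directed timelike tangent vectors. -/
def Future (X : Spacetime M) (p : M) (v : Eu 4) : Prop :=
  X.g p v v < 0 ∧ X.g p v (X.time p) < 0

/-- The 2-form `η_a^b = ½ √(-det g) g^{bβ} ε_{aβμν} dx^μ ∧ dx^ν` of the metric `B` at `p`,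
evaluated on `(u, v)`. -/
def eta (o : OrientationForm 4 M) (B : BilinField (Eu 4) M) (p : M) (a b : Fin 4)
    (u v : Eu 4) : ℝ :=
  ∑ β, (gram B p)⁻¹ b β * volForm o B p ![stdVec a, stdVec β, u, v]

/-- The 2-form
`(ω^a_b - ω̄^a_b) ∧ i_N η_a^b + D̄_b N^a (η_a^b - η̄_a^b)` at `p`, evaluated on `(u, v)`; the barred
quantities belong to the metric `B'`, the others to the metric `B`. -/
def cntForm (o : OrientationForm 4 M) (B B' : BilinField (Eu 4) M)
    (N : M → Eu 4) (p : M) (u v : Eu 4) : ℝ :=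
  ∑ a, ∑ b,
    (((connForm B p a b u - connForm B' p a b u) * eta o B p a b (N p) v
      - (connForm B p a b v - connForm B' p a b v) * eta o B p a b (N p) u)
      + covDerivComp B' N p b a * (eta o B p a b u v - eta o B' p a b u v))

/-- `φ : U → M'` is a reference near `K ⊆ M`: a smooth embedding of the open neighbourhood `U`
of `K` that preserves the orientation and the time orientation. -/
structure IsReference {M' : Type*} [TopologicalSpace M'] [ChartedSpace (Eu 4) M']
    [IsManifold (𝓡 4) ∞ M'] (X : Spacetime M) (Y : Spacetime M')
    (K U : Set M) (φ : M → M') : Prop where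
  isOpen : IsOpen U
  subset : K ⊆ U
  contMDiffOn : ContMDiffOn (𝓡 4) (𝓡 4) ∞ φ U
  injective_dmap : ∀ p ∈ U, Function.Injective (dmap (𝓡 4) (𝓡 4) φ p)
  isEmbedding : IsEmbedding (U.domRestrict φ)
  orient : ∀ p ∈ U, ∀ v : Fin 4 → Eu 4, 0 < X.orient.form p v →
    0 < Y.orient.form (φ p) (fun i => dmap (𝓡 4) (𝓡 4) φ p (v i))
  time : ∀ p ∈ U, ∀ v : Eu 4, X.Future p v →
    Y.g (φ p) (dmap (𝓡 4) (𝓡 4) φ p v) (dmap (𝓡 4) (𝓡 4) φ p v) < 0 →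
    Y.Future (φ p) (dmap (𝓡 4) (𝓡 4) φ p v)

/-- A 4D isometric matching reference: a reference with `φ^* ḡ = g` at the points of `K`. -/
structure IsMatchingReference {M' : Type*} [TopologicalSpace M'] [ChartedSpace (Eu 4) M']
    [IsManifold (𝓡 4) ∞ M'] (X : Spacetime M) (Y : Spacetime M')
    (K U : Set M) (φ : M → M') : Prop extends IsReference X Y K U φ where
  isometric : ∀ p ∈ K, pullbackBilin (𝓡 4) (𝓡 4) φ Y.g p = X.g p

/-- The Chen-Nester-Tung quasi-local energy (with `κ = 8π`) of the oriented closed surface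
`ι : S → M` with respect to `N` and the reference `φ` into the spacetime `Y`. -/
def cntEnergy {M' : Type*} [TopologicalSpace M'] [ChartedSpace (Eu 4) M']
    [IsManifold (𝓡 4) ∞ M'] (X : Spacetime M) (Y : Spacetime M')
    {S : Type*} [TopologicalSpace S] [ChartedSpace (Eu 2) S] [IsManifold (𝓡 2) ∞ S]
    [CompactSpace S] [T2Space S] (o : OrientationForm 2 S) (ι : S → M)
    (N : M → Eu 4) (φ : M → M') : ℝ :=
  1 / (2 * (8 * Real.pi)) * formIntegral o fun s u v =>
    cntForm X.orient X.g (pullbackBilin (𝓡 4) (𝓡 4) φ Y.g) N (ι s)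
      (dmap (𝓡 2) (𝓡 4) ι s u) (dmap (𝓡 2) (𝓡 4) ι s v)

end Spacetime

/-! ## Minkowski space -/

/-- The Euclidean inner product of `ℝⁿ`, as a bilinear form. -/
def euclidForm (n : ℕ) : Eu n →L[ℝ] Eu n →L[ℝ] ℝ := innerSL ℝ

theorem euclidForm_apply {n : ℕ} (u v : Eu n) : euclidForm n u v = inner ℝ u v := rfl

theorem chartFrame_self {n : ℕ} (p x : Eu n) :
    chartFrame (𝓡 n) p x = ContinuousLinearMap.id ℝ (Eu n) := by
  simp only [chartFrame, ModelWithCorners.range_eq_univ, mfderivWithin_univ]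
  exact mfderiv_id

/-- The bilinear form `-u⁰v⁰ + u¹v¹ + u²v² + u³v³`. -/
def minkowskiForm : Eu 4 →L[ℝ] Eu 4 →L[ℝ] ℝ :=
  euclidForm 4 -
    (2 : ℝ) • (euclidForm 4 (stdVec 0)).smulRight (euclidForm 4 (stdVec 0))

theorem minkowskiForm_apply (u v : Eu 4) :
    minkowskiForm u v = - (u 0 * v 0) + u 1 * v 1 + u 2 * v 2 + u 3 * v 3 := by
  have h : inner ℝ u v = u 0 * v 0 + u 1 * v 1 + u 2 * v 2 + u 3 * v 3 := by
    simp [PiLp.inner_apply, Fin.sum_univ_four]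
    ring
  simp [minkowskiForm, euclidForm_apply, stdVec, h, EuclideanSpace.inner_single_left]
  ring

/-- Minkowski space, with coordinates `(T, X, Y, Z) = (x⁰, x¹, x², x³)`, oriented by
`dT ∧ dX ∧ dY ∧ dZ` and time-oriented by `∂/∂T`. -/
def minkowski : Spacetime (Eu 4) where
  g := fun _ => minkowskiForm
  symm := by
    intro p u v
    change minkowskiForm u v = minkowskiForm v u
    rw [minkowskiForm_apply, minkowskiForm_apply]
    ring
  lorentz := by
    intro p
    refine ⟨(EuclideanSpace.basisFun (Fin 4) ℝ).toBasis, ?_⟩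
    intro i k
    change minkowskiForm ((EuclideanSpace.basisFun (Fin 4) ℝ).toBasis i)
      ((EuclideanSpace.basisFun (Fin 4) ℝ).toBasis k) = _
    rw [minkowskiForm_apply]
    fin_cases i <;> fin_cases k <;> simp
  smooth := by
    intro p
    have h : coordBilin (𝓡 4) (fun _ : Eu 4 => minkowskiForm) p = fun _ => minkowskiForm := by
      funext x
      simp [coordBilin, chartFrame_self]
      rfl
    rw [h]
    exact contDiffOn_const
  orient :=
    { form := fun _ => (EuclideanSpace.basisFun (Fin 4) ℝ).toBasis.det
      ne_zero := fun _ => (EuclideanSpace.basisFun (Fin 4) ℝ).toBasis.det_ne_zero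
      continuousOn := by
        intro p
        simp only [chartFrame_self]
        exact continuousOn_const }
  time := fun _ => (stdVec 0 : Eu 4)
  time_timelike := by
    intro p
    change minkowskiForm (stdVec 0) (stdVec 0) < 0
    rw [minkowskiForm_apply]
    simp [stdVec]
  time_continuous := by
    have h : ContMDiff (𝓡 4) (𝓡 4).tangent 0
        (fun p : Eu 4 => (⟨p, (stdVec 0 : Eu 4)⟩ : TangentBundle (𝓡 4) (Eu 4))) :=
      contMDiff_vectorSpace_iff_contDiff.2 (contDiff_const (c := (stdVec 0 : Eu 4)))
    exact h.continuous

/-- The spatial part `(X, Y, Z)` of `(T, X, Y, Z)`. -/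
def spatial : Eu 4 →L[ℝ] Eu 3 :=
  LinearMap.toContinuousLinearMap
    { toFun := fun x => WithLp.toLp 2 fun i : Fin 3 => x i.succ
      map_add' := fun _ _ => rfl
      map_smul' := fun _ _ => rfl }

/-! ## Outward normals and the Brown-York mass -/

section BrownYork

variable {S : Type*} [TopologicalSpace S] [ChartedSpace (Eu 2) S]

/-- `n` is the outward unit normal field of the closed surface `f : S → ℝ³`: the unit normal field
that points out of the bounded open set which is enclosed by the surface. -/
def IsOutwardNormalEuclidean (f : S → Eu 3) (n : S → Eu 3) : Prop :=
  ∃ D : Set (Eu 3), IsOpen D ∧ Bornology.IsBounded D ∧ frontier D = Set.range f ∧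
    ∀ s : S, inner ℝ (n s) (n s) = (1 : ℝ) ∧
      (∀ u : Eu 2, inner ℝ (n s) (dmap (𝓡 2) (𝓡 3) f s u) = (0 : ℝ)) ∧
      ∃ ε > 0, ∀ t ∈ Set.Ioo 0 ε, f s + t • n s ∉ closure D ∧ f s - t • n s ∈ D

variable {Ω : Type*} [TopologicalSpace Ω] [ChartedSpace (EuclideanHalfSpace 3) Ω]

/-- `ν` is the outward unit normal field, in the Riemannian 3-manifold with boundary `(Ω, B)`, of
its boundary, parametrized by `b : S → Ω`. The charts of `Ω` take values in the half-space
`{x | 0 ≤ x 0}`, so that a vector at the boundary points outwards when its component `0` is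
negative. -/
def IsOutwardNormalBoundary (B : BilinField (Eu 3) Ω) (b : S → Ω)
    (ν : S → Eu 3) : Prop :=
  ∀ s : S, B (b s) (ν s) (ν s) = 1 ∧
    (∀ u : Eu 2, B (b s) (ν s) (dmap (𝓡 2) (𝓡∂ 3) b s u) = 0) ∧
    ν s 0 < 0

/-- The Brown-York mass `(1/8π) ∫_S (k₀ - k) dV_S`, where `k` is the mean curvature of the boundary
`b : S → Ω` of `(Ω, B)` with respect to `ν`, and `k₀` is the mean curvature of `f : S → ℝ³` with
respect to `n₀`; these have to be the outward unit normal fields. -/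
def brownYorkMass [IsManifold (𝓡 2) ∞ S] [CompactSpace S] [T2Space S] (o : OrientationForm 2 S)
    (B : BilinField (Eu 3) Ω) (b : S → Ω) (ν : S → Eu 3)
    (f : S → Eu 3) (n₀ : S → Eu 3) : ℝ :=
  1 / (8 * Real.pi) * areaIntegral o (pullbackBilin (𝓡 2) (𝓡∂ 3) b B) fun s =>
    meanCurvature (𝓡 3) (fun _ => euclidForm 3) f n₀ s - meanCurvature (𝓡∂ 3) B b ν s

end BrownYork

end

/-!
Along `S` the vectors `N` and `ν` form an orthonormal frame of the normal bundle. Since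
`φ^*ḡ = g` there, `η̄ = η` and the `D̄N` term vanishes; moreover the derivatives of the two metrics
in directions tangent to `S` agree, so only the `ν`- and `N`-derivatives enter the difference of the
Levi-Civita connections. Contracting that difference with `i_N η` over an orthonormal frame of `S`
gives twice the difference of the mean curvature vectors of `S` for `φ^*ḡ` and `g`, paired with `ν`.
The mean curvature is natural under pullback, which identifies the two terms with the mean
curvatures of `φ(S)` in Minkowski space along `φ_*ν` and of `S` in `Ω` along `ν`. As `φ_*ν` is a
unit normal of `φ(S)` orthogonal to `φ_*N = ∂/∂T`, it lies in the slice, where unit normals are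
unique up to sign, so it is the outward normal and the first term is `k₀`.
-/

set_option maxSynthPendingDepth 3

section Calculus

variable {E₁ E₂ E₃ : Type*} [NormedAddCommGroup E₁] [NormedSpace ℝ E₁]
  [NormedAddCommGroup E₂] [NormedSpace ℝ E₂] [NormedAddCommGroup E₃] [NormedSpace ℝ E₃]

theorem differentiableWithinAt_fderivWithin_of_contDiffWithinAt {F : E₁ → E₂} {R : Set E₁}
    {x : E₁} (hF : ContDiffWithinAt ℝ 2 F R x) (hR : UniqueDiffOn ℝ R) (hx : x ∈ R) :
    DifferentiableWithinAt ℝ (fderivWithin ℝ F R) R x :=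
  (hF.fderivWithin_right (m := 1) hR (by norm_num) hx).differentiableWithinAt one_ne_zero

theorem differentiableWithinAt_flip {E₄ : Type*} [NormedAddCommGroup E₄] [NormedSpace ℝ E₄]
    {G : E₁ → E₂ →L[ℝ] E₃ →L[ℝ] E₄} {R : Set E₁} {x : E₁} (hG : DifferentiableWithinAt ℝ G R x) :
    DifferentiableWithinAt ℝ (fun y => (G y).flip) R x :=
  (ContinuousLinearMap.flipₗᵢ ℝ E₂ E₃ E₄).differentiableAt.comp_differentiableWithinAt x hG

theorem differentiableWithinAt_bilinearComp {G : E₁ → E₂ →L[ℝ] E₂ →L[ℝ] ℝ}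
    {A : E₁ → E₃ →L[ℝ] E₂} {R : Set E₁} {x : E₁} (hG : DifferentiableWithinAt ℝ G R x)
    (hA : DifferentiableWithinAt ℝ A R x) :
    DifferentiableWithinAt ℝ (fun y => (G y).bilinearComp (A y) (A y)) R x :=
  differentiableWithinAt_flip ((differentiableWithinAt_flip (hG.clm_comp hA)).clm_comp hA)

theorem fderivWithin_bilin_comp {F : E₁ → E₂} {G : E₂ → E₂ →L[ℝ] E₂ →L[ℝ] ℝ} {R : Set E₁}
    {R' : Set E₂} {x : E₁} (hG : DifferentiableWithinAt ℝ G R' (F x))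
    (hF : ContDiffWithinAt ℝ 2 F R x) (hR : UniqueDiffOn ℝ R) (hx : x ∈ R)
    (hRR' : Set.MapsTo F R R') (u v w : E₁) :
    fderivWithin ℝ (fun y => G (F y) (fderivWithin ℝ F R y v) (fderivWithin ℝ F R y w)) R x u =
      fderivWithin ℝ G R' (F x) (fderivWithin ℝ F R x u) (fderivWithin ℝ F R x v)
          (fderivWithin ℝ F R x w) +
        G (F x) (fderivWithin ℝ (fderivWithin ℝ F R) R x u v) (fderivWithin ℝ F R x w) +
        G (F x) (fderivWithin ℝ F R x v) (fderivWithin ℝ (fderivWithin ℝ F R) R x u w) := by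
  have hDF := (differentiableWithinAt_fderivWithin_of_contDiffWithinAt hF hR hx).hasFDerivWithinAt
  have hGF : HasFDerivWithinAt (fun y => G (F y)) _ R x :=
    HasFDerivWithinAt.comp (g := G) x hG.hasFDerivWithinAt
      (hF.differentiableWithinAt two_ne_zero).hasFDerivWithinAt hRR'
  have hprod := (hGF.clm_apply (hDF.clm_apply (hasFDerivWithinAt_const v x R))).clm_apply
    (hDF.clm_apply (hasFDerivWithinAt_const w x R))
  rw [hprod.fderivWithin (hR x hx)]
  simp only [ContinuousLinearMap.comp_zero, zero_add, ContinuousLinearMap.flip_add, add_apply,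
    ContinuousLinearMap.comp_apply, ContinuousLinearMap.flip_apply]
  ring

theorem fderivWithin_fderivWithin_comp {f : E₁ → E₂} {F : E₂ → E₃} {R : Set E₁} {R' : Set E₂}
    {x : E₁} (hF : ContDiffWithinAt ℝ 2 F R' (f x)) (hf : ContDiffWithinAt ℝ 2 f R x)
    (hR : UniqueDiffOn ℝ R) (hx : x ∈ R) (hR' : UniqueDiffOn ℝ R') (hRR' : Set.MapsTo f R R')
    (u v : E₁) :
    fderivWithin ℝ (fderivWithin ℝ (F ∘ f) R) R x u v =
      fderivWithin ℝ (fderivWithin ℝ F R') R' (f x) (fderivWithin ℝ f R x u)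
          (fderivWithin ℝ f R x v) +
        fderivWithin ℝ F R' (f x) (fderivWithin ℝ (fderivWithin ℝ f R) R x u v) := by
  have hf_near : ∀ᶠ y in 𝓝[R] x, ContDiffWithinAt ℝ 2 f R y := by
    simpa only [Set.insert_eq_of_mem hx] using hf.eventually (by simp)
  have hF_near : ∀ᶠ y in 𝓝[R] x, ContDiffWithinAt ℝ 2 F R' (f y) := by
    refine (hf.continuousWithinAt.tendsto_nhdsWithin hRR').eventually ?_
    simpa only [Set.insert_eq_of_mem (hRR' hx)] using hF.eventually (by simp)
  have hchain : fderivWithin ℝ (F ∘ f) R =ᶠ[𝓝[R] x]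
      fun y => (fderivWithin ℝ F R' (f y)).comp (fderivWithin ℝ f R y) := by
    filter_upwards [hf_near, hF_near, self_mem_nhdsWithin] with y hfy hFy hy
    exact fderivWithin_comp y (hFy.differentiableWithinAt two_ne_zero)
      (hfy.differentiableWithinAt two_ne_zero) hRR' (hR y hy)
  have hDF' := differentiableWithinAt_fderivWithin_of_contDiffWithinAt hF hR' (hRR' hx)
  have hDF : HasFDerivWithinAt (fun y => fderivWithin ℝ F R' (f y)) _ R x :=
    hDF'.hasFDerivWithinAt.comp x (hf.differentiableWithinAt two_ne_zero).hasFDerivWithinAt hRR'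
  have hDf := (differentiableWithinAt_fderivWithin_of_contDiffWithinAt hf hR hx).hasFDerivWithinAt
  rw [hchain.fderivWithin_eq_of_mem hx, (hDF.clm_comp hDf).fderivWithin (hR x hx)]
  simp [add_comm]

end Calculus

section Pullback

variable {E H E' H' E'' H'' : Type*} [NormedAddCommGroup E] [NormedSpace ℝ E] [TopologicalSpace H]
  [NormedAddCommGroup E'] [NormedSpace ℝ E'] [TopologicalSpace H']
  [NormedAddCommGroup E''] [NormedSpace ℝ E''] [TopologicalSpace H'']
  {Q : Type*} [TopologicalSpace Q] [ChartedSpace H Q]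
  {P : Type*} [TopologicalSpace P] [ChartedSpace H' P]
  {S : Type*} [TopologicalSpace S] [ChartedSpace H'' S]
  {I : ModelWithCorners ℝ E H} {J : ModelWithCorners ℝ E' H'} {K : ModelWithCorners ℝ E'' H''}

theorem eventually_extChartAt_symm {p : P} {a : P → Prop} (h : ∀ᶠ q in 𝓝 p, a q) :
    ∀ᶠ x in 𝓝[Set.range J] (extChartAt J p p), a ((extChartAt J p).symm x) := by
  rw [← map_extChartAt_symm_nhdsWithin_range (I := J) p] at h
  exact h

theorem extChartAt_self_mem_range (I : ModelWithCorners ℝ E H) (p : Q) :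
    extChartAt I p p ∈ Set.range I :=
  extChartAt_target_subset_range p (mem_extChartAt_target p)

theorem contDiffWithinAt_writtenInExtChartAt {n : ℕ∞ω} {f : P → Q} {p : P}
    (hf : ContMDiffAt J I n f p) :
    ContDiffWithinAt ℝ n (writtenInExtChartAt J I p f) (Set.range J) (extChartAt J p p) :=
  (contMDiffAt_iff.1 hf).2

theorem mapsTo_writtenInExtChartAt (f : P → Q) (p : P) (R : Set E') :
    Set.MapsTo (writtenInExtChartAt J I p f) R (Set.range I) := fun x _ => by
  simp only [writtenInExtChartAt, Function.comp_apply, extChartAt_coe]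
  exact Set.mem_range_self _

theorem writtenInExtChartAt_self (f : P → Q) (p : P) :
    writtenInExtChartAt J I p f (extChartAt J p p) = extChartAt I (f p) (f p) := by
  simp only [writtenInExtChartAt, Function.comp_apply, extChartAt_to_inv]

theorem dmap_eq_fderivWithin {f : P → Q} {p : P} (hf : MDifferentiableAt J I f p) :
    dmap J I f p =
      fderivWithin ℝ (writtenInExtChartAt J I p f) (Set.range J) (extChartAt J p p) :=
  hf.mfderiv

theorem dmap_comp {f : P → Q} {g : S → P} {s : S} (hf : MDifferentiableAt J I f (g s))
    (hg : MDifferentiableAt K J g s) (u : E'') :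
    dmap K I (f ∘ g) s u = dmap J I f (g s) (dmap K J g s u) :=
  congrArg (fun L : E'' →L[ℝ] E => L u) (mfderiv_comp s hf hg)

theorem chartFrame_extChartAt [IsManifold I 1 Q] (p : Q) :
    chartFrame I p (extChartAt I p p) = ContinuousLinearMap.id ℝ E :=
  mfderivWithin_range_extChartAt_symm

theorem chartFrame_comp_fderivWithin_writtenInExtChartAt [IsManifold J 1 P] [IsManifold I 1 Q]
    {f : P → Q} {p : P} {x : E'} (hx : x ∈ (extChartAt J p).target)
    (hf : MDifferentiableAt J I f ((extChartAt J p).symm x))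
    (hfx : f ((extChartAt J p).symm x) ∈ (extChartAt I (f p)).source) :
    (chartFrame I (f p) (writtenInExtChartAt J I p f x)).comp
        (fderivWithin ℝ (writtenInExtChartAt J I p f) (Set.range J) x) =
      (dmap J I f ((extChartAt J p).symm x)).comp (chartFrame J p x) := by
  have huniq : UniqueMDiffWithinAt 𝓘(ℝ, E') (Set.range J) x :=
    (J.uniqueDiffOn x (extChartAt_target_subset_range p hx)).uniqueMDiffWithinAt
  have hsymm := mdifferentiableWithinAt_extChartAt_symm (I := J) hx
  have hchart : MDifferentiableAt I 𝓘(ℝ, E) (extChartAt I (f p)) (f ((extChartAt J p).symm x)) :=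
    mdifferentiableAt_extChartAt (by rwa [extChartAt_source] at hfx)
  have hwritten : fderivWithin ℝ (writtenInExtChartAt J I p f) (Set.range J) x =
      (mfderiv I 𝓘(ℝ, E) (extChartAt I (f p)) (f ((extChartAt J p).symm x))).comp
        ((dmap J I f ((extChartAt J p).symm x)).comp (chartFrame J p x)) := by
    rw [← mfderivWithin_eq_fderivWithin]
    exact (mfderiv_comp_mfderivWithin x hchart
      (hf.comp_mdifferentiableWithinAt x hsymm) huniq).trans
      (congrArg _ (mfderiv_comp_mfderivWithin x hf hsymm huniq))
  rw [hwritten]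
  exact congrArg (fun L : E →L[ℝ] E => L.comp ((dmap J I f _).comp (chartFrame J p x)))
    (mfderivWithin_extChartAt_symm_comp_mfderiv_extChartAt' hfx)

theorem coordBilin_extChartAt [IsManifold I 1 Q] (B : BilinField E Q) (p : Q) :
    coordBilin I B p (extChartAt I p p) = B p := by
  ext v w
  rw [coordBilin, chartFrame_extChartAt, extChartAt_to_inv]
  rfl

theorem coordBilin_pullbackBilin [IsManifold J 1 P] [IsManifold I 1 Q] (B : BilinField E Q)
    {f : P → Q} {p : P} (hf : ∀ᶠ q in 𝓝 p, MDifferentiableAt J I f q) :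
    coordBilin J (pullbackBilin J I f B) p =ᶠ[𝓝[Set.range J] (extChartAt J p p)] fun x =>
      (coordBilin I B (f p) (writtenInExtChartAt J I p f x)).bilinearComp
        (fderivWithin ℝ (writtenInExtChartAt J I p f) (Set.range J) x)
        (fderivWithin ℝ (writtenInExtChartAt J I p f) (Set.range J) x) := by
  have hsource := hf.self_of_nhds.continuousAt.eventually
    (extChartAt_source_mem_nhds (I := I) (f p))
  filter_upwards [eventually_extChartAt_symm hf, eventually_extChartAt_symm hsource,
    extChartAt_target_mem_nhdsWithin p] with x hfx hsx hx
  have hback : (extChartAt I (f p)).symm (writtenInExtChartAt J I p f x) =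
      f ((extChartAt J p).symm x) := (extChartAt I (f p)).left_inv hsx
  have hframe (v : E') : chartFrame I (f p) (writtenInExtChartAt J I p f x)
      (fderivWithin ℝ (writtenInExtChartAt J I p f) (Set.range J) x v) =
      dmap J I f ((extChartAt J p).symm x) (chartFrame J p x v) :=
    DFunLike.congr_fun (chartFrame_comp_fderivWithin_writtenInExtChartAt hx hfx hsx) v
  ext v w
  simp only [coordBilin, pullbackBilin, ContinuousLinearMap.bilinearComp_apply, hback, hframe]

/-- Differentiability at `p` of a field of bilinear forms, in the preferred chart at `p`. -/
def BilinDifferentiableAt (I : ModelWithCorners ℝ E H) (B : BilinField E Q) (p : Q) : Prop :=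
  DifferentiableWithinAt ℝ (coordBilin I B p) (Set.range I) (extChartAt I p p)

/-- The derivative `(u, v, w) ↦ D_u (B(v, w))` at `p`, bundled as a trilinear map; it equals
`coordDeriv` where `B` is differentiable. -/
noncomputable def metricDeriv (I : ModelWithCorners ℝ E H) (B : BilinField E Q) (p : Q) :
    E →L[ℝ] E →L[ℝ] E →L[ℝ] ℝ :=
  fderivWithin ℝ (coordBilin I B p) (Set.range I) (extChartAt I p p)

/-- The second derivative at `p` of the representation of `f` in the preferred charts. -/
noncomputable def coordHess (J : ModelWithCorners ℝ E' H') (I : ModelWithCorners ℝ E H)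
    (f : P → Q) (p : P) : E' →L[ℝ] E' →L[ℝ] E :=
  fderivWithin ℝ (fderivWithin ℝ (writtenInExtChartAt J I p f) (Set.range J)) (Set.range J)
    (extChartAt J p p)

/-- The quantity `B(∇_u f_* v, n)`, with `∇` the Levi-Civita connection of `B`; for `n` normal
to `f` it is a component of the second fundamental form of `f`. -/
noncomputable def secondForm (J : ModelWithCorners ℝ E' H') (I : ModelWithCorners ℝ E H)
    (B : BilinField E Q) (f : P → Q) (p : P) (u v : E') (n : E) : ℝ :=
  B (f p) (coordHess J I f p u v) n +
    christoffelFirst I B (f p) (dmap J I f p u) (dmap J I f p v) n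

theorem coordDeriv_eq_metricDeriv {B : BilinField E Q} {p : Q} (hB : BilinDifferentiableAt I B p)
    (u v w : E) : coordDeriv I B p u v w = metricDeriv I B p u v w := by
  have h := (hB.hasFDerivWithinAt.clm_apply (hasFDerivWithinAt_const v _ _)).clm_apply
    (hasFDerivWithinAt_const w _ _)
  rw [coordDeriv, h.fderivWithin (I.uniqueDiffOn _ (extChartAt_self_mem_range I p))]
  simp [metricDeriv]

theorem hasFDerivWithinAt_coordBilin_comp {B : BilinField E Q} {f : P → Q} {p : P}
    (hB : BilinDifferentiableAt I B (f p)) (hf : MDifferentiableAt J I f p) :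
    HasFDerivWithinAt (fun x => coordBilin I B (f p) (writtenInExtChartAt J I p f x))
      ((metricDeriv I B (f p)).comp (dmap J I f p)) (Set.range J) (extChartAt J p p) := by
  have hB' : HasFDerivWithinAt (coordBilin I B (f p)) (metricDeriv I B (f p)) (Set.range I)
      (writtenInExtChartAt J I p f (extChartAt J p p)) := by
    rw [writtenInExtChartAt_self]
    exact hB.hasFDerivWithinAt
  rw [dmap_eq_fderivWithin hf]
  exact HasFDerivWithinAt.comp (g := coordBilin I B (f p)) _ hB'
    hf.differentiableWithinAt_writtenInExtChartAt.hasFDerivWithinAt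
    (mapsTo_writtenInExtChartAt f p _)

theorem metricDeriv_dmap_eq_of_eq_along {B B' : BilinField E Q} {f : P → Q} {p : P}
    (hB : BilinDifferentiableAt I B (f p)) (hB' : BilinDifferentiableAt I B' (f p))
    (hf : MDifferentiableAt J I f p) (h : ∀ q, B (f q) = B' (f q)) (u : E') :
    metricDeriv I B (f p) (dmap J I f p u) = metricDeriv I B' (f p) (dmap J I f p u) := by
  have hsource := hf.continuousAt.eventually (extChartAt_source_mem_nhds (I := I) (f p))
  have hagree : (fun x => coordBilin I B (f p) (writtenInExtChartAt J I p f x))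
      =ᶠ[𝓝[Set.range J] (extChartAt J p p)]
      fun x => coordBilin I B' (f p) (writtenInExtChartAt J I p f x) := by
    filter_upwards [eventually_extChartAt_symm hsource] with x hx
    have hback : (extChartAt I (f p)).symm (writtenInExtChartAt J I p f x) =
        f ((extChartAt J p).symm x) := (extChartAt I (f p)).left_inv hx
    simp only [coordBilin, hback, h]
  have hmem := extChartAt_self_mem_range J p
  have hderiv := hagree.fderivWithin_eq_of_mem (𝕜 := ℝ) hmem
  rw [(hasFDerivWithinAt_coordBilin_comp hB hf).fderivWithin (J.uniqueDiffOn _ hmem),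
    (hasFDerivWithinAt_coordBilin_comp hB' hf).fderivWithin (J.uniqueDiffOn _ hmem)] at hderiv
  exact DFunLike.congr_fun hderiv u

theorem eventually_mdifferentiableAt [IsManifold J 2 P] [IsManifold I 2 Q] {f : P → Q} {p : P}
    (hf : ContMDiffAt J I 2 f p) : ∀ᶠ q in 𝓝 p, MDifferentiableAt J I f q :=
  ((contMDiffAt_iff_contMDiffAt_nhds (by simp)).1 hf).mono fun _ hq =>
    hq.mdifferentiableAt two_ne_zero

theorem bilinDifferentiableAt_pullbackBilin [IsManifold J 2 P] [IsManifold I 2 Q]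
    {B : BilinField E Q} {f : P → Q} {p : P} (hB : BilinDifferentiableAt I B (f p))
    (hf : ContMDiffAt J I 2 f p) : BilinDifferentiableAt J (pullbackBilin J I f B) p := by
  have hmem := extChartAt_self_mem_range J p
  have hDf := differentiableWithinAt_fderivWithin_of_contDiffWithinAt
    (contDiffWithinAt_writtenInExtChartAt hf) J.uniqueDiffOn hmem
  have hBf := (hasFDerivWithinAt_coordBilin_comp hB
    (hf.mdifferentiableAt two_ne_zero)).differentiableWithinAt
  exact (differentiableWithinAt_bilinearComp hBf hDf).congr_of_eventuallyEq_of_mem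
    (coordBilin_pullbackBilin B (eventually_mdifferentiableAt hf)) hmem

theorem coordDeriv_pullbackBilin [IsManifold J 2 P] [IsManifold I 2 Q] {B : BilinField E Q}
    {f : P → Q} {p : P} (hB : BilinDifferentiableAt I B (f p)) (hf : ContMDiffAt J I 2 f p)
    (u v w : E') :
    coordDeriv J (pullbackBilin J I f B) p u v w =
      coordDeriv I B (f p) (dmap J I f p u) (dmap J I f p v) (dmap J I f p w) +
        B (f p) (coordHess J I f p u v) (dmap J I f p w) +
        B (f p) (dmap J I f p v) (coordHess J I f p u w) := by
  have hmem := extChartAt_self_mem_range J p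
  have hcoord : (fun x => coordBilin J (pullbackBilin J I f B) p x v w)
      =ᶠ[𝓝[Set.range J] (extChartAt J p p)] fun x =>
      coordBilin I B (f p) (writtenInExtChartAt J I p f x)
        (fderivWithin ℝ (writtenInExtChartAt J I p f) (Set.range J) x v)
        (fderivWithin ℝ (writtenInExtChartAt J I p f) (Set.range J) x w) := by
    filter_upwards [coordBilin_pullbackBilin B (eventually_mdifferentiableAt hf)] with x hx
    rw [hx]
    rfl
  rw [coordDeriv_eq_metricDeriv hB, coordDeriv, hcoord.fderivWithin_eq_of_mem hmem,
    fderivWithin_bilin_comp (R' := Set.range I) (by rwa [writtenInExtChartAt_self])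
      (contDiffWithinAt_writtenInExtChartAt hf) J.uniqueDiffOn hmem
      (mapsTo_writtenInExtChartAt f p _),
    writtenInExtChartAt_self, coordBilin_extChartAt,
    dmap_eq_fderivWithin (hf.mdifferentiableAt two_ne_zero)]
  rfl

theorem coordHess_symm {f : P → Q} {p : P} (hf : ContMDiffAt J I 2 f p) (u v : E') :
    coordHess J I f p u v = coordHess J I f p v u :=
  have hmem := extChartAt_self_mem_range J p
  (contDiffWithinAt_writtenInExtChartAt hf).isSymmSndFDerivWithinAt (by simp) J.uniqueDiffOn
    (J.range_subset_closure_interior hmem) hmem u v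

theorem christoffelFirst_pullbackBilin [IsManifold J 2 P] [IsManifold I 2 Q] {B : BilinField E Q}
    {f : P → Q} {p : P} (hB : BilinDifferentiableAt I B (f p))
    (hsymm : ∀ v w, B (f p) v w = B (f p) w v) (hf : ContMDiffAt J I 2 f p) (u v w : E') :
    christoffelFirst J (pullbackBilin J I f B) p u v w =
      secondForm J I B f p u v (dmap J I f p w) := by
  simp only [christoffelFirst, secondForm, coordDeriv_pullbackBilin hB hf]
  rw [coordHess_symm hf v u, coordHess_symm hf w u, coordHess_symm hf w v,
    hsymm (dmap J I f p v), hsymm (dmap J I f p u)]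
  ring

theorem coordHess_comp {f : P → Q} {g : S → P} {s : S} (hf : ContMDiffAt J I 2 f (g s))
    (hg : ContMDiffAt K J 2 g s) (u v : E'') :
    coordHess K I (f ∘ g) s u v =
      coordHess J I f (g s) (dmap K J g s u) (dmap K J g s v) +
        dmap J I f (g s) (coordHess K J g s u v) := by
  have hmem := extChartAt_self_mem_range K s
  have hsource := hg.continuousAt.eventually (extChartAt_source_mem_nhds (I := J) (g s))
  have hwritten : writtenInExtChartAt K I s (f ∘ g) =ᶠ[𝓝[Set.range K] (extChartAt K s s)]
      writtenInExtChartAt J I (g s) f ∘ writtenInExtChartAt K J s g := by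
    filter_upwards [eventually_extChartAt_symm hsource] with x hx
    simp only [writtenInExtChartAt, Function.comp_apply]
    rw [(extChartAt J (g s)).left_inv hx]
  have hF := contDiffWithinAt_writtenInExtChartAt hf
  rw [coordHess, hwritten.fderivWithin.fderivWithin_eq_of_mem hmem,
    fderivWithin_fderivWithin_comp (R' := Set.range J) (by rwa [writtenInExtChartAt_self])
      (contDiffWithinAt_writtenInExtChartAt hg) K.uniqueDiffOn hmem J.uniqueDiffOn
      (mapsTo_writtenInExtChartAt g s _), writtenInExtChartAt_self,
    dmap_eq_fderivWithin (hf.mdifferentiableAt two_ne_zero),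
    dmap_eq_fderivWithin (hg.mdifferentiableAt two_ne_zero)]
  rfl

theorem secondForm_pullbackBilin [IsManifold J 2 P] [IsManifold I 2 Q] {B : BilinField E Q}
    {f : P → Q} {g : S → P} {s : S} (hB : BilinDifferentiableAt I B (f (g s)))
    (hsymm : ∀ v w, B (f (g s)) v w = B (f (g s)) w v) (hf : ContMDiffAt J I 2 f (g s))
    (hg : ContMDiffAt K J 2 g s) (u v : E'') (n : E') :
    secondForm K J (pullbackBilin J I f B) g s u v n =
      secondForm K I B (f ∘ g) s u v (dmap J I f (g s) n) := by
  simp only [secondForm, christoffelFirst_pullbackBilin hB hsymm hf, coordHess_comp hf hg,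
    dmap_comp (hf.mdifferentiableAt two_ne_zero) (hg.mdifferentiableAt two_ne_zero), map_add,
    add_apply, Function.comp_apply, pullbackBilin, ContinuousLinearMap.bilinearComp_apply]
  ring

theorem pullbackBilin_comp {B : BilinField E Q} {f : P → Q} {g : S → P} {s : S}
    (hf : MDifferentiableAt J I f (g s)) (hg : MDifferentiableAt K J g s) :
    pullbackBilin K J g (pullbackBilin J I f B) s = pullbackBilin K I (f ∘ g) B s := by
  ext u v
  simp only [pullbackBilin, ContinuousLinearMap.bilinearComp_apply, dmap_comp hf hg,
    Function.comp_apply]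

end Pullback

section Koszul

variable {E H : Type*} [NormedAddCommGroup E] [NormedSpace ℝ E] [TopologicalSpace H]
  {Q : Type*} [TopologicalSpace Q] [ChartedSpace H Q] {I : ModelWithCorners ℝ E H}

/-- The right-hand side of the Koszul formula for the derivative `D` of a metric, as a bilinear
form in the last two arguments: `koszul (metricDeriv I B p)` is the Christoffel symbol of `B`. -/
noncomputable def koszul (D : E →L[ℝ] E →L[ℝ] E →L[ℝ] ℝ) (u : E) : E →L[ℝ] E →L[ℝ] ℝ :=
  (1 / 2 : ℝ) • (D u + D.flip u - (D.flip u).flip)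

theorem koszul_apply (D : E →L[ℝ] E →L[ℝ] E →L[ℝ] ℝ) (u v w : E) :
    koszul D u v w = 1 / 2 * (D u v w + D v u w - D w u v) := by
  simp [koszul]

theorem koszul_swap_of_eq_zero {D : E →L[ℝ] E →L[ℝ] E →L[ℝ] ℝ} {u : E} (hu : D u = 0) (v w : E) :
    koszul D u v w = -koszul D u w v := by
  simp only [koszul_apply, hu, zero_apply]
  ring

theorem koszul_of_eq_zero {D : E →L[ℝ] E →L[ℝ] E →L[ℝ] ℝ} {u v : E} (hu : D u = 0) (hv : D v = 0)
    (w : E) : koszul D u v w = -(1 / 2) * D w u v := by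
  simp only [koszul_apply, hu, hv, zero_apply]
  ring

theorem christoffelFirst_sub {B B' : BilinField E Q} {p : Q} (hB : BilinDifferentiableAt I B p)
    (hB' : BilinDifferentiableAt I B' p) (u v w : E) :
    christoffelFirst I B p u v w - christoffelFirst I B' p u v w =
      koszul (metricDeriv I B p - metricDeriv I B' p) u v w := by
  simp only [christoffelFirst, koszul_apply, coordDeriv_eq_metricDeriv hB,
    coordDeriv_eq_metricDeriv hB', sub_apply]
  ring

end Koszul

section MeanCurvature

variable {S : Type*} [TopologicalSpace S] [ChartedSpace (Eu 2) S] {E H E' H' : Type*}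
  [NormedAddCommGroup E] [NormedSpace ℝ E] [TopologicalSpace H]
  [NormedAddCommGroup E'] [NormedSpace ℝ E'] [TopologicalSpace H']
  {Q : Type*} [TopologicalSpace Q] [ChartedSpace H Q] {I : ModelWithCorners ℝ E H}
  {P : Type*} [TopologicalSpace P] [ChartedSpace H' P] {J : ModelWithCorners ℝ E' H'}

theorem meanCurvature_eq_sum_secondForm {B : BilinField E Q} {f : S → Q} {n : S → E} {s : S}
    (hf : MDifferentiableAt (𝓡 2) I f s) :
    meanCurvature I B f n s = -∑ i, ∑ k, (gram (pullbackBilin (𝓡 2) I f B) s)⁻¹ i k *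
      secondForm (𝓡 2) I B f s (stdVec i) (stdVec k) (n s) := by
  have hrange : Set.range (𝓡 2) = Set.univ := ModelWithCorners.range_eq_univ _
  simp only [meanCurvature, gram, pullbackBilin, ContinuousLinearMap.bilinearComp_apply, secondForm,
    coordHess, dmap_eq_fderivWithin hf, hrange, fderivWithin_univ, Finset.sum_neg_distrib]
  rfl

theorem meanCurvature_pullbackBilin [IsManifold (𝓡 2) 2 S] [IsManifold J 2 P] [IsManifold I 2 Q]
    {B : BilinField E Q} {f : P → Q} {g : S → P} {n : S → E'} {s : S}
    (hB : BilinDifferentiableAt I B (f (g s))) (hsymm : ∀ v w, B (f (g s)) v w = B (f (g s)) w v)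
    (hf : ContMDiffAt J I 2 f (g s)) (hg : ContMDiffAt (𝓡 2) J 2 g s) :
    meanCurvature J (pullbackBilin J I f B) g n s =
      meanCurvature I B (f ∘ g) (fun t => dmap J I f (g t) (n t)) s := by
  have hf' := hf.mdifferentiableAt two_ne_zero
  have hg' := hg.mdifferentiableAt two_ne_zero
  have hgram : gram (pullbackBilin (𝓡 2) J g (pullbackBilin J I f B)) s =
      gram (pullbackBilin (𝓡 2) I (f ∘ g) B) s := by
    simp only [gram, pullbackBilin_comp hf' hg']
  rw [meanCurvature_eq_sum_secondForm hg', meanCurvature_eq_sum_secondForm (hf'.comp s hg'), hgram]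
  simp only [secondForm_pullbackBilin hB hsymm hf hg]

theorem meanCurvature_sub {B B' : BilinField E Q} {f : S → Q} {n : S → E} {s : S}
    (hB : BilinDifferentiableAt I B (f s)) (hB' : BilinDifferentiableAt I B' (f s))
    (hf : MDifferentiableAt (𝓡 2) I f s) (hBB' : B (f s) = B' (f s)) :
    meanCurvature I B' f n s - meanCurvature I B f n s =
      ∑ i, ∑ k, (gram (pullbackBilin (𝓡 2) I f B) s)⁻¹ i k *
        koszul (metricDeriv I B (f s) - metricDeriv I B' (f s))
          (dmap (𝓡 2) I f s (stdVec i)) (dmap (𝓡 2) I f s (stdVec k)) (n s) := by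
  have hgram : gram (pullbackBilin (𝓡 2) I f B') s = gram (pullbackBilin (𝓡 2) I f B) s := by
    simp only [gram, pullbackBilin, hBB']
  rw [meanCurvature_eq_sum_secondForm hf, meanCurvature_eq_sum_secondForm hf, hgram, neg_sub_neg]
  simp only [← Finset.sum_sub_distrib, ← mul_sub, secondForm, hBB', add_sub_add_left_eq_sub,
    christoffelFirst_sub hB hB']

end MeanCurvature

section Constant

variable {S : Type*} [TopologicalSpace S] [ChartedSpace (Eu 2) S] {m n : ℕ}

theorem coordBilin_const (G : Eu n →L[ℝ] Eu n →L[ℝ] ℝ) (p x : Eu n) :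
    coordBilin (𝓡 n) (fun _ : Eu n => G) p x = G := by
  rw [coordBilin, chartFrame_self]
  rfl

theorem bilinDifferentiableAt_const (G : Eu n →L[ℝ] Eu n →L[ℝ] ℝ) (p : Eu n) :
    BilinDifferentiableAt (𝓡 n) (fun _ => G) p := by
  simp only [BilinDifferentiableAt, funext (coordBilin_const G p)]
  exact differentiableWithinAt_const G

theorem christoffelFirst_const (G : Eu n →L[ℝ] Eu n →L[ℝ] ℝ) (p u v w : Eu n) :
    christoffelFirst (𝓡 n) (fun _ : Eu n => G) p u v w = 0 := by
  simp [christoffelFirst, coordDeriv, coordBilin_const]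

theorem dmap_continuousLinearMap (L : Eu m →L[ℝ] Eu n) (p : Eu m) :
    dmap (𝓡 m) (𝓡 n) L p = L :=
  mfderiv_eq_fderiv.trans L.fderiv

theorem meanCurvature_const_congr {G G' : Eu n →L[ℝ] Eu n →L[ℝ] ℝ} {f : S → Eu n} {ν : S → Eu n}
    {s : S} (hf : MDifferentiableAt (𝓡 2) (𝓡 n) f s)
    (htangent : ∀ u v, G (dmap (𝓡 2) (𝓡 n) f s u) (dmap (𝓡 2) (𝓡 n) f s v) =
      G' (dmap (𝓡 2) (𝓡 n) f s u) (dmap (𝓡 2) (𝓡 n) f s v))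
    (hnormal : ∀ x, G x (ν s) = G' x (ν s)) :
    meanCurvature (𝓡 n) (fun _ => G) f ν s = meanCurvature (𝓡 n) (fun _ => G') f ν s := by
  simp only [meanCurvature_eq_sum_secondForm hf, gram, pullbackBilin, secondForm,
    ContinuousLinearMap.bilinearComp_apply, christoffelFirst_const, htangent, hnormal]

theorem minkowskiForm_eq_inner_spatial {x y : Eu 4} (hy : y 0 = 0) :
    minkowskiForm x y = inner ℝ (spatial x) (spatial y) := by
  rw [minkowskiForm_apply, hy, PiLp.inner_apply, Fin.sum_univ_three]
  change _ = y 1 * x 1 + y 2 * x 2 + y 3 * x 3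
  ring

theorem meanCurvature_minkowski_of_slice [IsManifold (𝓡 2) 2 S] {f ν : S → Eu 4} {s : S}
    (hf : ContMDiffAt (𝓡 2) (𝓡 4) 2 f s) (hfslice : ∀ u, dmap (𝓡 2) (𝓡 4) f s u 0 = 0)
    (hνslice : ν s 0 = 0) :
    meanCurvature (𝓡 4) minkowski.g f ν s =
      meanCurvature (𝓡 3) (fun _ => euclidForm 3) (spatial ∘ f) (fun t => spatial (ν t)) s := by
  have hspatial : pullbackBilin (𝓡 4) (𝓡 3) spatial (fun _ => euclidForm 3) =
      fun _ => (euclidForm 3).bilinearComp spatial spatial := by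
    funext p
    simp only [pullbackBilin, dmap_continuousLinearMap]
  calc meanCurvature (𝓡 4) (fun _ => minkowskiForm) f ν s
      = meanCurvature (𝓡 4) (fun _ => (euclidForm 3).bilinearComp spatial spatial) f ν s :=
        meanCurvature_const_congr (hf.mdifferentiableAt two_ne_zero)
          (fun u v => minkowskiForm_eq_inner_spatial (hfslice v))
          fun x => minkowskiForm_eq_inner_spatial hνslice
    _ = _ := by
        rw [← hspatial, meanCurvature_pullbackBilin (bilinDifferentiableAt_const _ _)
          (fun v w => real_inner_comm w v) spatial.contDiff.contMDiff.contMDiffAt hf]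
        simp only [dmap_continuousLinearMap]

end Constant

section Frames

variable {E F ι κ : Type*} [AddCommGroup E] [Module ℝ E] [AddCommGroup F] [Module ℝ F]
  [Fintype κ]

/-- The matrix `G(f_i, f_k)` of the bilinear form `G` on the family of vectors `f`. -/
def gramMatrix (G : LinearMap.BilinForm ℝ E) (f : ι → E) : Matrix ι ι ℝ :=
  Matrix.of fun i k => G (f i) (f k)

theorem gramMatrix_eq_mul (G : LinearMap.BilinForm ℝ E) (e : Module.Basis κ ℝ E) (f : ι → E) :
    gramMatrix G f = (e.toMatrix f).transpose * gramMatrix G e * e.toMatrix f := by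
  ext i k
  have hf (i : ι) : f i = ∑ a, e.toMatrix f a i • e a := (e.sum_toMatrix_smul_self f i).symm
  conv_lhs => rw [gramMatrix, Matrix.of_apply, hf i, hf k]
  simp only [map_sum, map_smul, LinearMap.sum_apply, LinearMap.smul_apply, smul_eq_mul,
    Matrix.mul_apply, Matrix.transpose_apply, gramMatrix, Matrix.of_apply, Finset.sum_mul,
    Finset.mul_sum]
  exact Finset.sum_congr rfl fun a _ => Finset.sum_congr rfl fun c _ => by ring

variable [Fintype ι] [DecidableEq ι] [DecidableEq κ]

theorem sum_inv_gramMatrix_mul_eq {G : LinearMap.BilinForm ℝ E} (e : Module.Basis κ ℝ E) {f : ι → E}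
    {K : Matrix ι ι ℝ} (hcard : Fintype.card ι = Fintype.card κ) (hK : K * gramMatrix G f = 1)
    (T : LinearMap.BilinForm ℝ E) :
    ∑ a, ∑ b, (gramMatrix G e)⁻¹ a b * T (e a) (e b) = ∑ i, ∑ k, K i k * T (f i) (f k) := by
  have hinv : (gramMatrix G e)⁻¹ = e.toMatrix f * K * (e.toMatrix f).transpose := by
    refine Matrix.inv_eq_left_inv ?_
    rw [gramMatrix_eq_mul G e f, ← Matrix.mul_assoc,
      ← Matrix.mul_eq_one_comm_of_card_eq _ _ _ hcard.symm] at hK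
    simpa only [Matrix.mul_assoc] using hK
  change ((gramMatrix G e)⁻¹ * (gramMatrix T e).transpose).trace =
    (K * (gramMatrix T f).transpose).trace
  rw [hinv, gramMatrix_eq_mul T e f, Matrix.transpose_mul, Matrix.transpose_mul,
    Matrix.transpose_transpose, Matrix.mul_assoc, Matrix.mul_assoc, Matrix.trace_mul_comm]
  simp only [Matrix.mul_assoc]

/-- `N` and `n` are orthogonal unit vectors, timelike and spacelike respectively, and orthogonal to
the image of `ℓ`, on which `G` is positive definite. If `ℓ` has codimension two, this is an
orthonormal normal frame of a spacelike immersion with derivative `ℓ`. -/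
structure IsNormalFrame (G : LinearMap.BilinForm ℝ E) (ℓ : F →ₗ[ℝ] E) (N n : E) : Prop where
  symm : ∀ x y, G x y = G y x
  timelike : G N N = -1
  spacelike : G n n = 1
  orthogonal : G N n = 0
  timelike_orthogonal : ∀ u, G N (ℓ u) = 0
  spacelike_orthogonal : ∀ u, G n (ℓ u) = 0
  pos : ∀ u ≠ 0, 0 < G (ℓ u) (ℓ u)

namespace IsNormalFrame

variable {G : LinearMap.BilinForm ℝ E} {ℓ : F →ₗ[ℝ] E} {N n : E}

theorem inv_symm (hG : IsNormalFrame G ℓ N n) (f : ι → F) (i k : ι) :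
    (gramMatrix G (ℓ ∘ f))⁻¹ i k = (gramMatrix G (ℓ ∘ f))⁻¹ k i :=
  (Matrix.IsSymm.inv
    (Matrix.ext fun _ _ => hG.symm _ _ : (gramMatrix G (ℓ ∘ f)).IsSymm)).apply k i

theorem det_ne_zero (hG : IsNormalFrame G ℓ N n) (f : Module.Basis ι ℝ F) :
    (gramMatrix G (ℓ ∘ f)).det ≠ 0 := by
  intro hdet
  obtain ⟨x, hx, hker⟩ := Matrix.exists_mulVec_eq_zero_iff.2 hdet
  have hne : ∑ i, x i • f i ≠ 0 := fun h =>
    hx (funext (Fintype.linearIndependent_iff.1 f.linearIndependent x h))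
  have hnorm : G (ℓ (∑ i, x i • f i)) (ℓ (∑ i, x i • f i)) =
      x ⬝ᵥ (gramMatrix G (ℓ ∘ f)).mulVec x := by
    simp only [map_sum, map_smul, LinearMap.sum_apply, LinearMap.smul_apply, smul_eq_mul,
      dotProduct, Matrix.mulVec, gramMatrix, Matrix.of_apply, Function.comp_apply, mul_comm]
    exact Finset.sum_congr rfl fun i _ => by simp only [hG.symm (ℓ (f i))]
  exact (hG.pos _ hne).ne' (by rw [hnorm, hker, dotProduct_zero])

theorem gramMatrix_frame {ι : Type*} (hG : IsNormalFrame G ℓ N n) (f : ι → F) :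
    gramMatrix G (Sum.elim ![N, n] (ℓ ∘ f)) =
      Matrix.fromBlocks (Matrix.diagonal ![-1, 1]) 0 0 (gramMatrix G (ℓ ∘ f)) := by
  ext (i | i) (k | k)
  · fin_cases i <;> fin_cases k <;>
      simp [gramMatrix, hG.timelike, hG.spacelike, hG.orthogonal, hG.symm n N]
  · fin_cases i <;> simp [gramMatrix, hG.timelike_orthogonal, hG.spacelike_orthogonal]
  · fin_cases k <;>
      simp [gramMatrix, hG.symm (ℓ (f i)), hG.timelike_orthogonal, hG.spacelike_orthogonal]
  · rfl

theorem sum_inv_gramMatrix_mul (hG : IsNormalFrame G ℓ N n) (e : Module.Basis κ ℝ E)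
    (f : Module.Basis ι ℝ F) (hcard : Fintype.card κ = Fintype.card ι + 2)
    (T : LinearMap.BilinForm ℝ E) :
    ∑ a, ∑ b, (gramMatrix G e)⁻¹ a b * T (e a) (e b) =
      -T N N + T n n + ∑ i, ∑ k, (gramMatrix G (ℓ ∘ f))⁻¹ i k * T (ℓ (f i)) (ℓ (f k)) := by
  have hinv : Matrix.fromBlocks (Matrix.diagonal ![-1, 1]) 0 0 (gramMatrix G (ℓ ∘ f))⁻¹ *
      gramMatrix G (Sum.elim ![N, n] (ℓ ∘ f)) = 1 := by
    have hdiag : (Matrix.diagonal ![-1, 1] * Matrix.diagonal ![-1, 1] :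
        Matrix (Fin 2) (Fin 2) ℝ) = 1 := by
      rw [Matrix.diagonal_mul_diagonal, ← Matrix.diagonal_one]
      congr 1
      ext i
      fin_cases i <;> simp
    simp [hG.gramMatrix_frame, Matrix.fromBlocks_multiply, hdiag,
      Matrix.nonsing_inv_mul _ (isUnit_iff_ne_zero.2 (hG.det_ne_zero f))]
  rw [sum_inv_gramMatrix_mul_eq e (by simp [hcard, add_comm]) hinv]
  simp [Fintype.sum_sum_type, Fin.sum_univ_two]

theorem sum_contraction (hG : IsNormalFrame G ℓ N n) (e : Module.Basis κ ℝ E)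
    (f : Module.Basis ι ℝ F) (hcard : Fintype.card κ = Fintype.card ι + 2)
    {C W : LinearMap.BilinForm ℝ E} (hC : ∀ x y, C x y = -C y x) (hW : W.IsAlt)
    (hWN : ∀ x, W N x = 0) (hWℓ : ∀ u v, W (ℓ u) (ℓ v) = 0) :
    ∑ a, ∑ d, (gramMatrix G e)⁻¹ a d *
        ∑ b, ∑ c, (gramMatrix G e)⁻¹ b c * (C (e b) (e d) * W (e a) (e c)) =
      2 * ∑ i, ∑ k, (gramMatrix G (ℓ ∘ f))⁻¹ i k * (W n (ℓ (f i)) * C (ℓ (f k)) n) := by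
  have hWN' (x : E) : W x N = 0 := by rw [← hW.neg_eq, hWN, neg_zero]
  have hinner (x y : E) := hG.sum_inv_gramMatrix_mul e f hcard
    ((LinearMap.mul ℝ ℝ).compl₁₂ (C.flip y) (W x))
  have houter := hG.sum_inv_gramMatrix_mul e f hcard
    ((LinearMap.mul ℝ ℝ).compl₁₂ (W.flip n) (C n) + ∑ i, ∑ k, (gramMatrix G (ℓ ∘ f))⁻¹ i k •
      (LinearMap.mul ℝ ℝ).compl₁₂ (W.flip (ℓ (f k))) (C (ℓ (f i))))
  simp only [LinearMap.compl₁₂_apply, LinearMap.mul_apply', LinearMap.BilinForm.flip_apply,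
    LinearMap.add_apply, LinearMap.sum_apply, LinearMap.smul_apply, smul_eq_mul, hWN, hWN', hWℓ,
    hW.self_eq_zero, mul_zero, zero_mul, neg_zero, zero_add, add_zero, Finset.sum_const_zero]
    at hinner houter
  simp only [hinner]
  simp only [mul_comm (C _ _), houter, two_mul]
  congr 1
  · rw [Finset.sum_comm]
    exact Finset.sum_congr rfl fun i _ => Finset.sum_congr rfl fun k _ => by rw [hG.inv_symm]
  · refine Finset.sum_congr rfl fun i _ => Finset.sum_congr rfl fun k _ => ?_
    rw [hC n, ← hW.neg_eq n, neg_mul_neg]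

end IsNormalFrame

end Frames

section Volume

theorem coe_basisFun_toBasis (n : ℕ) :
    ⇑(EuclideanSpace.basisFun (Fin n) ℝ).toBasis = stdVec := by
  ext1 i
  simp [stdVec]

theorem basisFun_det_apply {n : ℕ} (v : Fin n → Eu n) :
    (EuclideanSpace.basisFun (Fin n) ℝ).toBasis.det v = (Matrix.of fun i k => v i k).det := by
  rw [Module.Basis.det_apply, ← Matrix.det_transpose]
  rfl

theorem gram_eq_gramMatrix {n : ℕ} {Q : Type*} (B : BilinField (Eu n) Q) (p : Q) :
    gram B p = gramMatrix (B p).toBilinForm (EuclideanSpace.basisFun (Fin n) ℝ).toBasis := by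
  rw [coe_basisFun_toBasis]
  rfl

theorem twoForm_apply (σ : Eu 2 [⋀^Fin 2]→ₗ[ℝ] ℝ) (u v : Eu 2) :
    σ ![u, v] = σ ![stdVec 0, stdVec 1] * (u 0 * v 1 - u 1 * v 0) := by
  conv_lhs => rw [σ.eq_smul_basis_det (EuclideanSpace.basisFun (Fin 2) ℝ).toBasis]
  rw [AlternatingMap.smul_apply, basisFun_det_apply, smul_eq_mul, coe_basisFun_toBasis,
    Matrix.det_fin_two]
  congr 2
  ext i
  fin_cases i <;> rfl

theorem mul_twoForm_sub_mul_twoForm (α : Eu 2 →ₗ[ℝ] ℝ) (σ : Eu 2 [⋀^Fin 2]→ₗ[ℝ] ℝ) (t u v : Eu 2) :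
    α u * σ ![t, v] - α v * σ ![t, u] = α t * σ ![u, v] := by
  have hα (x : Eu 2) : α x = x 0 * α (stdVec 0) + x 1 * α (stdVec 1) := by
    conv_lhs => rw [← (EuclideanSpace.basisFun (Fin 2) ℝ).toBasis.sum_repr x]
    simp [Fin.sum_univ_two, stdVec]
  rw [twoForm_apply σ t v, twoForm_apply σ t u, twoForm_apply σ u v, hα t, hα u, hα v]
  ring

theorem sign_eq_sign_of_twoForm_pos {σ τ : Eu 2 [⋀^Fin 2]→ₗ[ℝ] ℝ} (hτ : τ ≠ 0)
    (h : ∀ u v, 0 < τ ![u, v] → 0 < σ ![u, v]) (u v : Eu 2) :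
    SignType.sign (τ ![u, v]) = SignType.sign (σ ![u, v]) := by
  have hswap (ρ : Eu 2 [⋀^Fin 2]→ₗ[ℝ] ℝ) : ρ ![v, u] = -ρ ![u, v] := by
    rw [twoForm_apply ρ v u, twoForm_apply ρ u v]
    ring
  rcases lt_trichotomy (τ ![u, v]) 0 with hneg | hzero | hpos
  · rw [sign_neg hneg, sign_neg]
    have hpos := h v u (by rw [hswap]; exact neg_pos.2 hneg)
    rwa [hswap, neg_pos] at hpos
  · have hτe : τ ![stdVec 0, stdVec 1] ≠ 0 := fun h0 => hτ <| by
      ext w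
      rw [show w = ![w 0, w 1] from List.ofFn_inj.1 rfl, twoForm_apply, h0, zero_mul]
      rfl
    rw [twoForm_apply] at hzero
    rw [twoForm_apply τ, twoForm_apply σ, (mul_eq_zero.1 hzero).resolve_left hτe, mul_zero,
      mul_zero]
  · rw [sign_pos hpos, sign_pos (h u v hpos)]

variable {n : ℕ} {Q : Type*} [TopologicalSpace Q] [ChartedSpace (Eu n) Q]

/-- `volForm o B p` as an alternating map. -/
noncomputable def volAlternating (o : OrientationForm n Q) (B : BilinField (Eu n) Q) (p : Q) :
    Eu n [⋀^Fin n]→ₗ[ℝ] ℝ :=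
  ((SignType.sign (o.form p stdVec) : ℝ) * √|(gram B p).det|) •
    (EuclideanSpace.basisFun (Fin n) ℝ).toBasis.det

theorem volAlternating_apply (o : OrientationForm n Q) (B : BilinField (Eu n) Q) (p : Q)
    (v : Fin n → Eu n) : volAlternating o B p v = volForm o B p v := by
  rw [volAlternating, AlternatingMap.smul_apply, basisFun_det_apply, smul_eq_mul, volForm]

theorem volForm_eq_sign_mul_sqrt (o : OrientationForm n Q) (B : BilinField (Eu n) Q) (p : Q)
    (v : Fin n → Eu n) : volForm o B p v =
      SignType.sign (o.form p v) * √|(gramMatrix (B p).toBilinForm v).det| := by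
  have hform : o.form p v = o.form p stdVec * (Matrix.of fun i k => v i k).det := by
    conv_lhs => rw [(o.form p).eq_smul_basis_det (EuclideanSpace.basisFun (Fin n) ℝ).toBasis]
    rw [AlternatingMap.smul_apply, basisFun_det_apply, smul_eq_mul, coe_basisFun_toBasis]
  have hgram : (gramMatrix (B p).toBilinForm v).det =
      (Matrix.of fun i k => v i k).det ^ 2 * (gram B p).det := by
    rw [gramMatrix_eq_mul _ (EuclideanSpace.basisFun (Fin n) ℝ).toBasis, Matrix.det_mul,
      Matrix.det_mul, Matrix.det_transpose, ← gram_eq_gramMatrix, ← Module.Basis.det_apply,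
      basisFun_det_apply]
    ring
  rw [hform, hgram, abs_mul, abs_sq, Real.sqrt_mul (sq_nonneg _), Real.sqrt_sq_eq_abs, sign_mul,
    SignType.coe_mul, mul_assoc, ← mul_assoc _ |_|, sign_mul_abs, volForm]
  ring

theorem det_gramMatrix_frame {G : LinearMap.BilinForm ℝ (Eu 4)} {ℓ : Eu 2 →ₗ[ℝ] Eu 4} {N n : Eu 4}
    (hG : IsNormalFrame G ℓ N n) (u v : Eu 2) :
    (gramMatrix G ![N, n, ℓ u, ℓ v]).det = -(gramMatrix G ![ℓ u, ℓ v]).det := by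
  simp [gramMatrix, Matrix.det_succ_row_zero, Fin.sum_univ_succ, Fin.succAbove, hG.timelike,
    hG.spacelike, hG.orthogonal, hG.timelike_orthogonal, hG.spacelike_orthogonal, hG.symm n N,
    hG.symm (ℓ u) N, hG.symm (ℓ v) N, hG.symm (ℓ u) n, hG.symm (ℓ v) n]

/-- The 2-form `σ(u, v) = θ(N, n, ℓ u, ℓ v)`. -/
noncomputable def contractFrame (θ : Eu 4 [⋀^Fin 4]→ₗ[ℝ] ℝ) (N n : Eu 4) (ℓ : Eu 2 →ₗ[ℝ] Eu 4) :
    Eu 2 [⋀^Fin 2]→ₗ[ℝ] ℝ :=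
  ((θ.curryLeft N).curryLeft n).compLinearMap ℓ

theorem contractFrame_apply (θ : Eu 4 [⋀^Fin 4]→ₗ[ℝ] ℝ) (N n : Eu 4) (ℓ : Eu 2 →ₗ[ℝ] Eu 4)
    (u v : Eu 2) : contractFrame θ N n ℓ ![u, v] = θ ![N, n, ℓ u, ℓ v] := by
  simp only [contractFrame, AlternatingMap.compLinearMap_apply,
    AlternatingMap.curryLeft_apply_apply]
  congr 1
  ext1 i
  fin_cases i <;> rfl

theorem volForm_pullbackBilin {S M : Type*} [TopologicalSpace S] [ChartedSpace (Eu 2) S]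
    [TopologicalSpace M] [ChartedSpace (Eu 4) M] {o' : OrientationForm 2 S}
    {o : OrientationForm 4 M} {B : BilinField (Eu 4) M} {f : S → M} {s : S} {N n : Eu 4}
    (hB : IsNormalFrame (B (f s)).toBilinForm (dmap (𝓡 2) (𝓡 4) f s).toLinearMap N n)
    (ho : ∀ u v, 0 < o'.form s ![u, v] → 0 < o.form (f s)
      ![N, n, dmap (𝓡 2) (𝓡 4) f s u, dmap (𝓡 2) (𝓡 4) f s v]) (u v : Eu 2) :
    volForm o' (pullbackBilin (𝓡 2) (𝓡 4) f B) s ![u, v] =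
      volForm o B (f s) ![N, n, dmap (𝓡 2) (𝓡 4) f s u, dmap (𝓡 2) (𝓡 4) f s v] := by
  have hgram : gramMatrix (pullbackBilin (𝓡 2) (𝓡 4) f B s).toBilinForm ![u, v] =
      gramMatrix (B (f s)).toBilinForm
        ![dmap (𝓡 2) (𝓡 4) f s u, dmap (𝓡 2) (𝓡 4) f s v] := by
    ext i k
    fin_cases i <;> fin_cases k <;> rfl
  have hsign := sign_eq_sign_of_twoForm_pos
    (σ := contractFrame (o.form (f s)) N n (dmap (𝓡 2) (𝓡 4) f s).toLinearMap) (o'.ne_zero s)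
    (fun u v h => (contractFrame_apply ..).symm ▸ ho u v h) u v
  rw [volForm_eq_sign_mul_sqrt, volForm_eq_sign_mul_sqrt, hsign, contractFrame_apply, hgram]
  have hdet := det_gramMatrix_frame hB u v
  simp only [ContinuousLinearMap.coe_coe] at hdet ⊢
  rw [hdet, abs_neg]

end Volume

section ChenNesterTung

theorem fourForm_rotate (θ : Eu 4 [⋀^Fin 4]→ₗ[ℝ] ℝ) (x y z w : Eu 4) :
    θ ![x, y, z, w] = θ ![z, x, y, w] := by
  have hperm := θ.map_perm ![x, y, z, w] (Equiv.swap 0 2 * Equiv.swap 1 2)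
  have hvec : ![x, y, z, w] ∘ ⇑(Equiv.swap 0 2 * Equiv.swap 1 2 : Equiv.Perm (Fin 4)) =
      ![z, x, y, w] := by
    ext1 i
    fin_cases i <;> rfl
  rw [hvec, Equiv.Perm.sign_mul, Equiv.Perm.sign_swap (by decide),
    Equiv.Perm.sign_swap (by decide)] at hperm
  simpa using hperm.symm

theorem alternating_rangeTriple_eq_zero (θ : Eu 4 [⋀^Fin 4]→ₗ[ℝ] ℝ) (N : Eu 4)
    (ℓ : Eu 2 →ₗ[ℝ] Eu 4) (u v w : Eu 2) : θ ![N, ℓ u, ℓ v, ℓ w] = 0 := by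
  have hdep : ¬LinearIndependent ℝ ![u, v, w] := fun h => by
    have hcard := h.fintype_card_le_finrank
    simp at hcard
  have hzero := ((θ.curryLeft N).compLinearMap ℓ).map_linearDependent ![u, v, w] hdep
  rw [← hzero, AlternatingMap.compLinearMap_apply, AlternatingMap.curryLeft_apply_apply]
  congr 1
  ext1 i
  fin_cases i <;> rfl

/-- The bilinear form `(x, y) ↦ θ(x, y, N, v)`; with `θ` the volume form it is `i_N η(v)` with both
indices lowered. -/
noncomputable def contractLast (θ : Eu 4 [⋀^Fin 4]→ₗ[ℝ] ℝ) (N v : Eu 4) :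
    LinearMap.BilinForm ℝ (Eu 4) :=
  LinearMap.mk₂ ℝ (fun x y => θ ![x, y, N, v]) (fun x x' _ => θ.map_vecCons_add _ x x')
    (fun c x _ => θ.map_vecCons_smul _ c x) (fun x y y' => (θ.curryLeft x).map_vecCons_add _ y y')
    (fun c x y => (θ.curryLeft x).map_vecCons_smul _ c y)

theorem contractLast_apply (θ : Eu 4 [⋀^Fin 4]→ₗ[ℝ] ℝ) (N v x y : Eu 4) :
    contractLast θ N v x y = θ ![x, y, N, v] := rfl

theorem contractLast_isAlt (θ : Eu 4 [⋀^Fin 4]→ₗ[ℝ] ℝ) (N v : Eu 4) :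
    (contractLast θ N v).IsAlt := fun x =>
  θ.map_eq_zero_of_eq ![x, x, N, v] (i := 0) (j := 1) rfl (by decide)

theorem contractLast_left (θ : Eu 4 [⋀^Fin 4]→ₗ[ℝ] ℝ) (N v x : Eu 4) :
    contractLast θ N v N x = 0 :=
  θ.map_eq_zero_of_eq ![N, x, N, v] (i := 0) (j := 2) rfl (by decide)

theorem contractLast_range (θ : Eu 4 [⋀^Fin 4]→ₗ[ℝ] ℝ) (N : Eu 4) (ℓ : Eu 2 →ₗ[ℝ] Eu 4)
    (u v w : Eu 2) : contractLast θ N (ℓ w) (ℓ u) (ℓ v) = 0 := by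
  rw [contractLast_apply, fourForm_rotate, alternating_rangeTriple_eq_zero]

theorem sum_koszul_mul_contractLast {G : LinearMap.BilinForm ℝ (Eu 4)} {ℓ : Eu 2 →ₗ[ℝ] Eu 4}
    {N n : Eu 4} (hG : IsNormalFrame G ℓ N n) {D : Eu 4 →L[ℝ] Eu 4 →L[ℝ] Eu 4 →L[ℝ] ℝ}
    (hD : ∀ w, D (ℓ w) = 0) (θ : Eu 4 [⋀^Fin 4]→ₗ[ℝ] ℝ) (u v : Eu 2) :
    ∑ a, ∑ d, (gramMatrix G stdVec)⁻¹ a d * ∑ b, ∑ c, (gramMatrix G stdVec)⁻¹ b c *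
        (koszul D (ℓ u) (stdVec b) (stdVec d) * contractLast θ N (ℓ v) (stdVec a) (stdVec c)) =
      -∑ i, ∑ k, (gramMatrix G (ℓ ∘ stdVec))⁻¹ i k *
        (contractFrame θ N n ℓ ![stdVec i, v] * D n (ℓ u) (ℓ (stdVec k))) := by
  have hcontraction := hG.sum_contraction (EuclideanSpace.basisFun (Fin 4) ℝ).toBasis
    (EuclideanSpace.basisFun (Fin 2) ℝ).toBasis (by simp) (C := (koszul D (ℓ u)).toBilinForm)
    (koszul_swap_of_eq_zero (hD u)) (contractLast_isAlt θ N (ℓ v)) (contractLast_left θ N (ℓ v))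
    fun x y => contractLast_range θ N ℓ x y v
  rw [coe_basisFun_toBasis, coe_basisFun_toBasis] at hcontraction
  refine hcontraction.trans ?_
  simp only [Finset.mul_sum, ← Finset.sum_neg_distrib]
  refine Finset.sum_congr rfl fun i _ => Finset.sum_congr rfl fun k _ => ?_
  rw [contractLast_apply, fourForm_rotate, contractFrame_apply,
    ContinuousLinearMap.toBilinForm_apply, koszul_of_eq_zero (hD u) (hD _)]
  ring

variable {M : Type*} [TopologicalSpace M] [ChartedSpace (Eu 4) M]
  {B B' : BilinField (Eu 4) M}

theorem connForm_sub {p : M} (hB : BilinDifferentiableAt (𝓡 4) B p)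
    (hB' : BilinDifferentiableAt (𝓡 4) B' p) (hBB' : B p = B' p) (a b : Fin 4) (u : Eu 4) :
    connForm B p a b u - connForm B' p a b u = ∑ d, (gram B p)⁻¹ a d *
      koszul (metricDeriv (𝓡 4) B p - metricDeriv (𝓡 4) B' p) u (stdVec b) (stdVec d) := by
  have hgram : gram B' p = gram B p := by simp only [gram, hBB']
  simp only [connForm, hgram, ← Finset.sum_sub_distrib, ← mul_sub, christoffelFirst_sub hB hB']

variable {o : OrientationForm 4 M}

theorem eta_eq_sum_contractLast (p : M) (a b : Fin 4) (x y : Eu 4) :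
    Spacetime.eta o B p a b x y = ∑ c, (gram B p)⁻¹ b c *
      contractLast (volAlternating o B p) x y (stdVec a) (stdVec c) := by
  simp only [Spacetime.eta, contractLast_apply, volAlternating_apply]

theorem eta_congr {p : M} (hBB' : B p = B' p) (a b : Fin 4) (x y : Eu 4) :
    Spacetime.eta o B p a b x y = Spacetime.eta o B' p a b x y := by
  simp only [Spacetime.eta, volForm, gram, hBB']

variable {S : Type*} [TopologicalSpace S] [ChartedSpace (Eu 2) S] {f : S → M}
  {s : S} {n : S → Eu 4}

theorem sum_connForm_sub_mul_eta {N n : Eu 4} (hB : BilinDifferentiableAt (𝓡 4) B (f s))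
    (hB' : BilinDifferentiableAt (𝓡 4) B' (f s)) (hf : MDifferentiableAt (𝓡 2) (𝓡 4) f s)
    (hBB' : ∀ t, B (f t) = B' (f t))
    (hframe : IsNormalFrame (B (f s)).toBilinForm (dmap (𝓡 2) (𝓡 4) f s).toLinearMap N n)
    (u v : Eu 2) :
    ∑ a, ∑ b, (connForm B (f s) a b (dmap (𝓡 2) (𝓡 4) f s u) -
        connForm B' (f s) a b (dmap (𝓡 2) (𝓡 4) f s u)) *
          Spacetime.eta o B (f s) a b N (dmap (𝓡 2) (𝓡 4) f s v) =
      -∑ i, ∑ k, (gram (pullbackBilin (𝓡 2) (𝓡 4) f B) s)⁻¹ i k *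
        (contractFrame (volAlternating o B (f s)) N n (dmap (𝓡 2) (𝓡 4) f s).toLinearMap
            ![stdVec i, v] *
          (metricDeriv (𝓡 4) B (f s) - metricDeriv (𝓡 4) B' (f s)) n (dmap (𝓡 2) (𝓡 4) f s u)
            (dmap (𝓡 2) (𝓡 4) f s (stdVec k))) := by
  refine Eq.trans (Finset.sum_congr rfl fun a _ => ?_) (sum_koszul_mul_contractLast hframe
    (fun w => sub_eq_zero.2 (metricDeriv_dmap_eq_of_eq_along hB hB' hf hBB' w))
    (volAlternating o B (f s)) u v)
  simp only [connForm_sub hB hB' (hBB' s), eta_eq_sum_contractLast, Finset.sum_mul_sum]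
  rw [Finset.sum_comm]
  simp only [Finset.mul_sum]
  refine Finset.sum_congr rfl fun d _ => Finset.sum_congr rfl fun b _ =>
    Finset.sum_congr rfl fun c _ => ?_
  rw [mul_mul_mul_comm, mul_assoc]
  rfl

theorem cntForm_eq_meanCurvature_sub {N : M → Eu 4} (hB : BilinDifferentiableAt (𝓡 4) B (f s))
    (hB' : BilinDifferentiableAt (𝓡 4) B' (f s)) (hf : MDifferentiableAt (𝓡 2) (𝓡 4) f s)
    (hBB' : ∀ t, B (f t) = B' (f t))
    (hframe : IsNormalFrame (B (f s)).toBilinForm (dmap (𝓡 2) (𝓡 4) f s).toLinearMap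
      (N (f s)) (n s)) (u v : Eu 2) :
    Spacetime.cntForm o B B' N (f s) (dmap (𝓡 2) (𝓡 4) f s u) (dmap (𝓡 2) (𝓡 4) f s v) =
      2 * (meanCurvature (𝓡 4) B' f n s - meanCurvature (𝓡 4) B f n s) *
        volForm o B (f s)
          ![N (f s), n s, dmap (𝓡 2) (𝓡 4) f s u, dmap (𝓡 2) (𝓡 4) f s v] := by
  set D := metricDeriv (𝓡 4) B (f s) - metricDeriv (𝓡 4) B' (f s) with hD
  set σ := contractFrame (volAlternating o B (f s)) (N (f s)) (n s)
    (dmap (𝓡 2) (𝓡 4) f s).toLinearMap with hσ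
  have hDtangent (w : Eu 2) : D (dmap (𝓡 2) (𝓡 4) f s w) = 0 :=
    sub_eq_zero.2 (metricDeriv_dmap_eq_of_eq_along hB hB' hf hBB' w)
  have hvol : volForm o B (f s) ![N (f s), n s, dmap (𝓡 2) (𝓡 4) f s u,
      dmap (𝓡 2) (𝓡 4) f s v] = σ ![u, v] := by
    rw [hσ, contractFrame_apply, volAlternating_apply]
    rfl
  have htwoForm (k t : Fin 2) :
      D (n s) (dmap (𝓡 2) (𝓡 4) f s u) (dmap (𝓡 2) (𝓡 4) f s (stdVec k)) * σ ![stdVec t, v] -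
          D (n s) (dmap (𝓡 2) (𝓡 4) f s v) (dmap (𝓡 2) (𝓡 4) f s (stdVec k)) * σ ![stdVec t, u] =
        D (n s) (dmap (𝓡 2) (𝓡 4) f s (stdVec t)) (dmap (𝓡 2) (𝓡 4) f s (stdVec k)) * σ ![u, v] :=
    mul_twoForm_sub_mul_twoForm ((D (n s)).flip (dmap (𝓡 2) (𝓡 4) f s (stdVec k)) ∘L
      dmap (𝓡 2) (𝓡 4) f s).toLinearMap σ (stdVec t) u v
  simp only [Spacetime.cntForm, eta_congr (o := o) (hBB' s), sub_self, mul_zero, add_zero]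
  simp only [← eta_congr (o := o) (hBB' s), Finset.sum_sub_distrib,
    sum_connForm_sub_mul_eta hB hB' hf hBB' hframe, ← hD, ← hσ]
  rw [meanCurvature_sub hB hB' hf (hBB' s), hvol, ← hD]
  simp only [koszul_of_eq_zero (hDtangent _) (hDtangent _), neg_sub_neg, ← Finset.sum_sub_distrib,
    Finset.mul_sum, Finset.sum_mul]
  refine Finset.sum_congr rfl fun i _ => Finset.sum_congr rfl fun k _ => ?_
  linear_combination (-(gram (pullbackBilin (𝓡 2) (𝓡 4) f B) s)⁻¹ i k) * htwoForm k i

end ChenNesterTung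

section Energy

variable {S : Type*} [TopologicalSpace S] [ChartedSpace (Eu 2) S] [IsManifold (𝓡 2) ∞ S]
  [CompactSpace S] [T2Space S] {M M' : Type*} [TopologicalSpace M] [ChartedSpace (Eu 4) M]
  [IsManifold (𝓡 4) ∞ M] [TopologicalSpace M'] [ChartedSpace (Eu 4) M'] [IsManifold (𝓡 4) ∞ M']

theorem formIntegral_const_mul (o : OrientationForm 2 S) (c : ℝ) (α : S → Eu 2 → Eu 2 → ℝ) :
    formIntegral o (fun s u v => c * α s u v) = c * formIntegral o α := by
  simp only [formIntegral]
  rw [← smul_eq_mul, smul_finsum]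
  refine finsum_congr fun i => ?_
  rw [smul_eq_mul, ← MeasureTheory.integral_const_mul]
  congr 1
  funext x
  ring

theorem Spacetime.bilinDifferentiableAt (X : Spacetime M) (p : M) :
    BilinDifferentiableAt (𝓡 4) X.g p :=
  (((X.smooth p).contDiffAt (extChartAt_target_mem_nhds p)).differentiableAt
    (by simp)).differentiableWithinAt

theorem Spacetime.cntEnergy_eq_areaIntegral (X : Spacetime M) (Y : Spacetime M')
    {o : OrientationForm 2 S} {f : S → M} {N : M → Eu 4} {n : S → Eu 4} {φ : M → M'}
    (hf : ∀ s, ContMDiffAt (𝓡 2) (𝓡 4) 2 f s) (hφ : ∀ s, ContMDiffAt (𝓡 4) (𝓡 4) 2 φ (f s))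
    (hiso : ∀ s, pullbackBilin (𝓡 4) (𝓡 4) φ Y.g (f s) = X.g (f s))
    (hframe : ∀ s, IsNormalFrame (X.g (f s)).toBilinForm (dmap (𝓡 2) (𝓡 4) f s).toLinearMap
      (N (f s)) (n s))
    (ho : ∀ s u v, 0 < o.form s ![u, v] → 0 < X.orient.form (f s)
      ![N (f s), n s, dmap (𝓡 2) (𝓡 4) f s u, dmap (𝓡 2) (𝓡 4) f s v]) :
    X.cntEnergy Y o f N φ = 1 / (8 * Real.pi) *
      areaIntegral o (pullbackBilin (𝓡 2) (𝓡 4) f X.g) fun s =>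
        meanCurvature (𝓡 4) Y.g (φ ∘ f) (fun t => dmap (𝓡 4) (𝓡 4) φ (f t) (n t)) s -
          meanCurvature (𝓡 4) X.g f n s := by
  have hY (s : S) : BilinDifferentiableAt (𝓡 4) (pullbackBilin (𝓡 4) (𝓡 4) φ Y.g) (f s) :=
    bilinDifferentiableAt_pullbackBilin (Y.bilinDifferentiableAt _) (hφ s)
  have hintegrand (s : S) (u v : Eu 2) :=
    cntForm_eq_meanCurvature_sub (o := X.orient) (X.bilinDifferentiableAt (f s)) (hY s)
      ((hf s).mdifferentiableAt two_ne_zero) (fun t => (hiso t).symm) (hframe s) u v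
  simp only [Spacetime.cntEnergy, hintegrand, ← volForm_pullbackBilin (hframe _) (ho _),
    meanCurvature_pullbackBilin (Y.bilinDifferentiableAt _) (Y.symm _) (hφ _) (hf _), mul_assoc,
    formIntegral_const_mul, areaIntegral]
  ring

end Energy

section Minkowski

theorem minkowskiForm_stdVec_zero (x : Eu 4) : minkowskiForm (stdVec 0) x = -x 0 := by
  rw [minkowskiForm_apply]
  simp [stdVec]

theorem unitNormal_unique {V : Type*} [NormedAddCommGroup V] [InnerProductSpace ℝ V]
    [FiniteDimensional ℝ V] {W : Submodule ℝ V}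
    (hW : Module.finrank ℝ W + 1 = Module.finrank ℝ V) {m n : V} (hm : inner ℝ m m = (1 : ℝ))
    (hn : inner ℝ n n = (1 : ℝ)) (hmW : m ∈ Wᗮ) (hnW : n ∈ Wᗮ) (hmn : 0 < inner ℝ m n) :
    m = n := by
  have hline : Module.finrank ℝ Wᗮ = 1 := by
    have := W.finrank_add_finrank_orthogonal
    lia
  have hm0 : (⟨m, hmW⟩ : Wᗮ) ≠ 0 := fun h => by
    rw [Subtype.mk_eq_mk.1 h, inner_zero_left] at hm
    exact zero_ne_one hm
  obtain ⟨c, hc⟩ := (finrank_eq_one_iff_of_nonzero' _ hm0).1 hline ⟨n, hnW⟩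
  have hcm : c • m = n := congrArg Subtype.val hc
  rw [← hcm, inner_smul_right, hm, mul_one] at hmn
  have hnorm : ‖m‖ = ‖n‖ := by
    rw [norm_eq_sqrt_real_inner, norm_eq_sqrt_real_inner, hm, hn]
  exact (sameRay_iff_of_norm_eq hnorm).1 (hcm ▸ SameRay.sameRay_nonneg_smul_right m hmn.le)

variable {S : Type*} [TopologicalSpace S] [ChartedSpace (Eu 2) S]
  {Ω : Type*} [TopologicalSpace Ω] [ChartedSpace (EuclideanHalfSpace 3) Ω]

theorem inner_spatial_dmap {ψ : Ω → Eu 4} {q : Ω}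
    (hslice : ∀ w, dmap (𝓡∂ 3) (𝓡 4) ψ q w 0 = 0) (v w : Eu 3) :
    inner ℝ (spatial (dmap (𝓡∂ 3) (𝓡 4) ψ q v)) (spatial (dmap (𝓡∂ 3) (𝓡 4) ψ q w)) =
      pullbackBilin (𝓡∂ 3) (𝓡 4) ψ minkowski.g q v w :=
  (minkowskiForm_eq_inner_spatial (hslice w)).symm

theorem unitNormal_eq_spatial_dmap {ψ : Ω → Eu 4} {b : S → Ω} {s : S} {m v : Eu 3}
    (hψ : MDifferentiableAt (𝓡∂ 3) (𝓡 4) ψ (b s)) (hb : MDifferentiableAt (𝓡 2) (𝓡∂ 3) b s)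
    (hb_inj : Function.Injective (dmap (𝓡 2) (𝓡∂ 3) b s))
    (hslice : ∀ w, dmap (𝓡∂ 3) (𝓡 4) ψ (b s) w 0 = 0)
    (hpos : ∀ w ≠ 0, 0 < pullbackBilin (𝓡∂ 3) (𝓡 4) ψ minkowski.g (b s) w w)
    (hv : pullbackBilin (𝓡∂ 3) (𝓡 4) ψ minkowski.g (b s) v v = 1)
    (hv_normal : ∀ u, pullbackBilin (𝓡∂ 3) (𝓡 4) ψ minkowski.g (b s) v
      (dmap (𝓡 2) (𝓡∂ 3) b s u) = 0)
    (hm : inner ℝ m m = (1 : ℝ))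
    (hm_normal : ∀ u, inner ℝ m (dmap (𝓡 2) (𝓡 3) (spatial ∘ ψ ∘ b) s u) = (0 : ℝ))
    (hmv : 0 < inner ℝ m (spatial (dmap (𝓡∂ 3) (𝓡 4) ψ (b s) v))) :
    m = spatial (dmap (𝓡∂ 3) (𝓡 4) ψ (b s) v) := by
  set A : Eu 3 →L[ℝ] Eu 3 := spatial ∘L dmap (𝓡∂ 3) (𝓡 4) ψ (b s)
  have hAinner (w w' : Eu 3) :
      inner ℝ (A w) (A w') = pullbackBilin (𝓡∂ 3) (𝓡 4) ψ minkowski.g (b s) w w' :=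
    inner_spatial_dmap hslice w w'
  have hAinj : Function.Injective A := (injective_iff_map_eq_zero A).2 fun w hw => by
    by_contra hw0
    have hww := hpos w hw0
    rw [← hAinner, hw, inner_zero_left] at hww
    exact hww.false
  have hdmap (u : Eu 2) : dmap (𝓡 2) (𝓡 3) (spatial ∘ ψ ∘ b) s u =
      A (dmap (𝓡 2) (𝓡∂ 3) b s u) := by
    have hspatial : MDifferentiableAt (𝓡 4) (𝓡 3) spatial (ψ (b s)) :=
      spatial.mdifferentiableAt
    rw [← Function.comp_assoc, dmap_comp (hspatial.comp (b s) hψ) hb, dmap_comp hspatial hψ,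
      dmap_continuousLinearMap]
    rfl
  refine unitNormal_unique (W := ((A ∘L dmap (𝓡 2) (𝓡∂ 3) b s).toLinearMap).range) ?_ hm
    ((hAinner v v).trans hv) ?_ ?_ hmv
  · have hinj : Function.Injective (A ∘L dmap (𝓡 2) (𝓡∂ 3) b s) := hAinj.comp hb_inj
    rw [LinearMap.finrank_range_of_inj hinj]
    simp
  · rintro - ⟨u, rfl⟩
    rw [real_inner_comm]
    exact hdmap u ▸ hm_normal u
  · rintro - ⟨u, rfl⟩
    rw [real_inner_comm]
    exact (hAinner _ _).trans (hv_normal u)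

theorem meanCurvature_minkowski_eq_euclidean [IsManifold (𝓡 2) 2 S] [IsManifold (𝓡∂ 3) 2 Ω]
    {ψ : Ω → Eu 4} {b : S → Ω} {ν n : S → Eu 3} (hψ : ∀ s, ContMDiffAt (𝓡∂ 3) (𝓡 4) 2 ψ (b s))
    (hb : ContMDiff (𝓡 2) (𝓡∂ 3) 2 b) (hb_inj : ∀ s, Function.Injective (dmap (𝓡 2) (𝓡∂ 3) b s))
    (hslice : ∀ s w, dmap (𝓡∂ 3) (𝓡 4) ψ (b s) w 0 = 0)
    (hpos : ∀ s, ∀ w ≠ 0, 0 < pullbackBilin (𝓡∂ 3) (𝓡 4) ψ minkowski.g (b s) w w)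
    (hν : ∀ s, pullbackBilin (𝓡∂ 3) (𝓡 4) ψ minkowski.g (b s) (ν s) (ν s) = 1)
    (hν_normal : ∀ s u, pullbackBilin (𝓡∂ 3) (𝓡 4) ψ minkowski.g (b s) (ν s)
      (dmap (𝓡 2) (𝓡∂ 3) b s u) = 0)
    (hn : ∀ s, inner ℝ (n s) (n s) = (1 : ℝ))
    (hn_normal : ∀ s u, inner ℝ (n s) (dmap (𝓡 2) (𝓡 3) (spatial ∘ ψ ∘ b) s u) = (0 : ℝ))
    (hnν : ∀ s, 0 < inner ℝ (n s) (spatial (dmap (𝓡∂ 3) (𝓡 4) ψ (b s) (ν s)))) (s : S) :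
    meanCurvature (𝓡 4) minkowski.g (ψ ∘ b) (fun t => dmap (𝓡∂ 3) (𝓡 4) ψ (b t) (ν t)) s =
      meanCurvature (𝓡 3) (fun _ => euclidForm 3) (spatial ∘ ψ ∘ b) n s := by
  have hdψ (t : S) := (hψ t).mdifferentiableAt two_ne_zero
  have hdb (t : S) := (hb t).mdifferentiableAt two_ne_zero
  have hnormal (t : S) : n t = spatial (dmap (𝓡∂ 3) (𝓡 4) ψ (b t) (ν t)) :=
    unitNormal_eq_spatial_dmap (hdψ t) (hdb t) (hb_inj t) (hslice t) (hpos t) (hν t) (hν_normal t)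
      (hn t) (hn_normal t) (hnν t)
  have htangent (u : Eu 2) : dmap (𝓡 2) (𝓡 4) (ψ ∘ b) s u 0 = 0 := by
    rw [dmap_comp (hdψ s) (hdb s), hslice]
  rw [meanCurvature_minkowski_of_slice ((hψ s).comp s (hb s)) htangent (hslice s _), funext hnormal]

end Minkowski

section Hypersurface

variable {M M' : Type*} [TopologicalSpace M] [ChartedSpace (Eu 4) M] [IsManifold (𝓡 4) ∞ M]
  [TopologicalSpace M'] [ChartedSpace (Eu 4) M'] [IsManifold (𝓡 4) ∞ M']
  {Ω : Type*} [TopologicalSpace Ω] [ChartedSpace (EuclideanHalfSpace 3) Ω]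
  {S : Type*} [TopologicalSpace S] [ChartedSpace (Eu 2) S]

theorem Spacetime.IsReference.contMDiffAt {X : Spacetime M} {Y : Spacetime M'}
    {K U : Set M} {φ : M → M'} (hφ : Spacetime.IsReference X Y K U φ) {p : M} (hp : p ∈ K) :
    ContMDiffAt (𝓡 4) (𝓡 4) ∞ φ p :=
  hφ.contMDiffOn.contMDiffAt (hφ.isOpen.mem_nhds (hφ.subset hp))

theorem Spacetime.isNormalFrame_hypersurface {X : Spacetime M} {j : Ω → M} {b : S → Ω} {s : S}
    {N : Eu 4} {v : Eu 3} (hj : MDifferentiableAt (𝓡∂ 3) (𝓡 4) j (b s))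
    (hb : MDifferentiableAt (𝓡 2) (𝓡∂ 3) b s)
    (hb_inj : Function.Injective (dmap (𝓡 2) (𝓡∂ 3) b s))
    (hpos : ∀ w ≠ 0, 0 < pullbackBilin (𝓡∂ 3) (𝓡 4) j X.g (b s) w w)
    (hN : X.g (j (b s)) N N = -1)
    (hN_normal : ∀ w, X.g (j (b s)) N (dmap (𝓡∂ 3) (𝓡 4) j (b s) w) = 0)
    (hv : pullbackBilin (𝓡∂ 3) (𝓡 4) j X.g (b s) v v = 1)
    (hv_normal : ∀ u, pullbackBilin (𝓡∂ 3) (𝓡 4) j X.g (b s) v (dmap (𝓡 2) (𝓡∂ 3) b s u) = 0) :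
    IsNormalFrame (X.g (j (b s))).toBilinForm (dmap (𝓡 2) (𝓡 4) (j ∘ b) s).toLinearMap N
      (dmap (𝓡∂ 3) (𝓡 4) j (b s) v) where
  symm := X.symm _
  timelike := hN
  spacelike := hv
  orthogonal := hN_normal v
  timelike_orthogonal u := (congrArg (X.g _ N) (dmap_comp hj hb u)).trans (hN_normal _)
  spacelike_orthogonal u := (congrArg (X.g _ _) (dmap_comp hj hb u)).trans (hv_normal u)
  pos u hu := by
    rw [ContinuousLinearMap.coe_coe, dmap_comp hj hb]
    exact hpos _ ((map_ne_zero_iff _ hb_inj).2 hu)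

theorem Spacetime.cntEnergy_hypersurface [IsManifold (𝓡∂ 3) 2 Ω] [IsManifold (𝓡 2) ∞ S]
    [CompactSpace S] [T2Space S] (X : Spacetime M) (Y : Spacetime M') {j : Ω → M} {b : S → Ω}
    {ν : S → Eu 3} {N : M → Eu 4} {o : OrientationForm 2 S} {φ : M → M'}
    (hj : ∀ s, ContMDiffAt (𝓡∂ 3) (𝓡 4) 2 j (b s)) (hb : ContMDiff (𝓡 2) (𝓡∂ 3) 2 b)
    (hφ : ∀ s, ContMDiffAt (𝓡 4) (𝓡 4) 2 φ (j (b s)))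
    (hiso : ∀ s, pullbackBilin (𝓡 4) (𝓡 4) φ Y.g (j (b s)) = X.g (j (b s)))
    (hframe : ∀ s, IsNormalFrame (X.g (j (b s))).toBilinForm
      (dmap (𝓡 2) (𝓡 4) (j ∘ b) s).toLinearMap (N (j (b s)))
      (dmap (𝓡∂ 3) (𝓡 4) j (b s) (ν s)))
    (ho : ∀ s u v, 0 < o.form s ![u, v] →
      0 < X.orient.form (j (b s)) ![N (j (b s)), dmap (𝓡∂ 3) (𝓡 4) j (b s) (ν s),
        dmap (𝓡 2) (𝓡 4) (j ∘ b) s u, dmap (𝓡 2) (𝓡 4) (j ∘ b) s v]) :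
    X.cntEnergy Y o (j ∘ b) N φ = 1 / (8 * Real.pi) *
      areaIntegral o (pullbackBilin (𝓡 2) (𝓡∂ 3) b (pullbackBilin (𝓡∂ 3) (𝓡 4) j X.g)) fun s =>
        meanCurvature (𝓡 4) Y.g ((φ ∘ j) ∘ b)
            (fun t => dmap (𝓡∂ 3) (𝓡 4) (φ ∘ j) (b t) (ν t)) s -
          meanCurvature (𝓡∂ 3) (pullbackBilin (𝓡∂ 3) (𝓡 4) j X.g) b ν s := by
  have hdj (s : S) := (hj s).mdifferentiableAt two_ne_zero
  have hdb (s : S) := (hb s).mdifferentiableAt two_ne_zero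
  have hdφ (s : S) := (hφ s).mdifferentiableAt two_ne_zero
  have harea : pullbackBilin (𝓡 2) (𝓡∂ 3) b (pullbackBilin (𝓡∂ 3) (𝓡 4) j X.g) =
      pullbackBilin (𝓡 2) (𝓡 4) (j ∘ b) X.g :=
    funext fun s => pullbackBilin_comp (hdj s) (hdb s)
  simp only [X.cntEnergy_eq_areaIntegral Y (fun s => (hj s).comp s (hb s)) hφ hiso hframe ho, harea,
    meanCurvature_pullbackBilin (X.bilinDifferentiableAt _) (X.symm _) (hj _) (hb _),
    dmap_comp (hdφ _) (hdj _)]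
  rfl

theorem corollary1p2_general [IsManifold (𝓡∂ 3) 2 Ω] [IsManifold (𝓡 2) ∞ S] [CompactSpace S]
    [T2Space S] (X : Spacetime M) {j : Ω → M} {b : S → Ω} {ν : S → Eu 3} {N : M → Eu 4}
    {o : OrientationForm 2 S} {φ : M → Eu 4} {n₀ : S → Eu 3}
    (hj : ∀ s, ContMDiffAt (𝓡∂ 3) (𝓡 4) 2 j (b s))
    (hΩ : ∀ (s : S) (w : Eu 3), w ≠ 0 → 0 < pullbackBilin (𝓡∂ 3) (𝓡 4) j X.g (b s) w w)
    (hb : ContMDiff (𝓡 2) (𝓡∂ 3) 2 b) (hb_inj : ∀ s, Function.Injective (dmap (𝓡 2) (𝓡∂ 3) b s))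
    (hν : IsOutwardNormalBoundary (pullbackBilin (𝓡∂ 3) (𝓡 4) j X.g) b ν)
    (hNnormal : ∀ (s : S) (w : Eu 3),
      X.g (j (b s)) (N (j (b s))) (dmap (𝓡∂ 3) (𝓡 4) j (b s) w) = 0)
    (ho : ∀ (s : S) (u v : Eu 2), 0 < o.form s ![u, v] →
      0 < X.orient.form (j (b s)) ![N (j (b s)), dmap (𝓡∂ 3) (𝓡 4) j (b s) (ν s),
        dmap (𝓡 2) (𝓡 4) (j ∘ b) s u, dmap (𝓡 2) (𝓡 4) (j ∘ b) s v])
    (hφ : ∀ s, ContMDiffAt (𝓡 4) (𝓡 4) 2 φ (j (b s)))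
    (hφiso : ∀ s, pullbackBilin (𝓡 4) (𝓡 4) φ minkowski.g (j (b s)) = X.g (j (b s)))
    (hφN : ∀ s, dmap (𝓡 4) (𝓡 4) φ (j (b s)) (N (j (b s))) = (stdVec 0 : Eu 4))
    (hn₀ : IsOutwardNormalEuclidean (fun s => spatial (φ (j (b s)))) n₀)
    (hout : ∀ s, 0 < inner ℝ (n₀ s) (spatial (dmap (𝓡 4) (𝓡 4) φ (j (b s))
      (dmap (𝓡∂ 3) (𝓡 4) j (b s) (ν s))))) :
    X.cntEnergy minkowski o (j ∘ b) N φ =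
      brownYorkMass o (pullbackBilin (𝓡∂ 3) (𝓡 4) j X.g) b ν
        (fun s => spatial (φ (j (b s)))) n₀ := by
  have hisometry (s : S) (v w : Eu 4) : minkowskiForm (dmap (𝓡 4) (𝓡 4) φ (j (b s)) v)
      (dmap (𝓡 4) (𝓡 4) φ (j (b s)) w) = X.g (j (b s)) v w := by rw [← hφiso s]; rfl
  have hdj (s : S) := (hj s).mdifferentiableAt two_ne_zero
  have hdφ (s : S) := (hφ s).mdifferentiableAt two_ne_zero
  have hNN (s : S) : X.g (j (b s)) (N (j (b s))) (N (j (b s))) = -1 := by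
    rw [← hisometry, hφN, minkowskiForm_stdVec_zero]
    simp [stdVec]
  have hslice (s : S) (w : Eu 3) : dmap (𝓡∂ 3) (𝓡 4) (φ ∘ j) (b s) w 0 = 0 := by
    rw [dmap_comp (hdφ s) (hdj s), ← neg_eq_zero, ← minkowskiForm_stdVec_zero, ← hφN s, hisometry,
      hNnormal]
  have hmetric (s : S) : pullbackBilin (𝓡∂ 3) (𝓡 4) (φ ∘ j) minkowski.g (b s) =
      pullbackBilin (𝓡∂ 3) (𝓡 4) j X.g (b s) := by
    rw [← pullbackBilin_comp (hdφ s) (hdj s), pullbackBilin, hφiso, pullbackBilin]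
  have hframe (s : S) := Spacetime.isNormalFrame_hypersurface (hdj s)
    ((hb s).mdifferentiableAt two_ne_zero) (hb_inj s) (hΩ s) (hNN s) (hNnormal s) (hν s).1
    (hν s).2.1
  obtain ⟨_, -, -, -, hn₀⟩ := hn₀
  have hk₀ := meanCurvature_minkowski_eq_euclidean (ψ := φ ∘ j)
    (fun s => (hφ s).comp (b s) (hj s)) hb hb_inj hslice (fun s => hmetric s ▸ hΩ s)
    (fun s => hmetric s ▸ (hν s).1) (fun s => hmetric s ▸ (hν s).2.1) (fun s => (hn₀ s).1)
    (fun s => (hn₀ s).2.1) fun s => (dmap_comp (hdφ s) (hdj s) (ν s)).symm ▸ hout s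
  rw [X.cntEnergy_hypersurface minkowski hj hb hφ hφiso hframe ho, funext hk₀]
  rfl

end Hypersurface

theorem corollary1p2
    {M : Type*} [TopologicalSpace M] [ChartedSpace (Eu 4) M] [IsManifold (𝓡 4) ∞ M]
    {Ω : Type*} [TopologicalSpace Ω] [ChartedSpace (EuclideanHalfSpace 3) Ω]
    [IsManifold (𝓡∂ 3) ∞ Ω] [CompactSpace Ω]
    {S : Type*} [TopologicalSpace S] [ChartedSpace (Eu 2) S] [IsManifold (𝓡 2) ∞ S]
    [CompactSpace S] [T2Space S]
    -- the physical spacetime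
    (X : Spacetime M)
    -- the compact spacelike domain `Ω` in `M`, with boundary `S` and outward unit normal `ν`
    (j : Ω → M) (hj : IsSmoothEmb (𝓡∂ 3) (𝓡 4) j)
    (hΩ : ∀ (q : Ω) (w : TangentSpace (𝓡∂ 3) q), w ≠ 0 →
      0 < pullbackBilin (𝓡∂ 3) (𝓡 4) j X.g q w w)
    (b : S → Ω) (hb : IsSmoothEmb (𝓡 2) (𝓡∂ 3) b) (hbS : Set.range b = (𝓡∂ 3).boundary Ω)
    (ν : ∀ s : S, TangentSpace (𝓡∂ 3) (b s))
    (hν : IsOutwardNormalBoundary (pullbackBilin (𝓡∂ 3) (𝓡 4) j X.g) b ν)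
    -- the future-directed timelike field `N`, defined and smooth near `S` and normal to `Ω` on `S`
    (U : Set M) (N : ∀ p : M, TangentSpace (𝓡 4) p)
    (hN : ContMDiffOn (𝓡 4) (𝓡 4).tangent ∞ (fun p => (⟨p, N p⟩ : TangentBundle (𝓡 4) M)) U)
    (hNfuture : ∀ s : S, X.Future (j (b s)) (N (j (b s))))
    (hNnormal : ∀ (s : S) (w : TangentSpace (𝓡∂ 3) (b s)),
      X.g (j (b s)) (N (j (b s))) (dmap (𝓡∂ 3) (𝓡 4) j (b s) w) = 0)
    -- `N`, the outward normal and the orientation of `S` form the orientation of `M`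
    (o : OrientationForm 2 S)
    (ho : ∀ (s : S) (u v : TangentSpace (𝓡 2) s), 0 < o.form s ![u, v] →
      0 < X.orient.form (j (b s)) ![N (j (b s)), dmap (𝓡∂ 3) (𝓡 4) j (b s) (ν s),
        dmap (𝓡 2) (𝓡 4) (j ∘ b) s u, dmap (𝓡 2) (𝓡 4) (j ∘ b) s v])
    -- the reference, with `φ_* N = ∂/∂T` and `φ(S)` contained in a slice `{T = c}`, i.e. in `ℝ³`
    (φ : M → Eu 4)
    (hφ : Spacetime.IsMatchingReference X minkowski (Set.range (j ∘ b)) U φ)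
    (hφN : ∀ s : S, dmap (𝓡 4) (𝓡 4) φ (j (b s)) (N (j (b s))) = (stdVec 0 : Eu 4))
    (c : ℝ) (hφS : ∀ s : S, φ (j (b s)) 0 = c)
    -- the outward unit normal of `φ(S)` in `ℝ³`, and `φ` maps the outward side to the outward side
    (n₀ : S → Eu 3)
    (hn₀ : IsOutwardNormalEuclidean (fun s => spatial (φ (j (b s)))) n₀)
    (hout : ∀ s : S, 0 < inner ℝ (n₀ s) (spatial (dmap (𝓡 4) (𝓡 4) φ (j (b s))
      (dmap (𝓡∂ 3) (𝓡 4) j (b s) (ν s))))) :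
    X.cntEnergy minkowski o (j ∘ b) N φ =
      brownYorkMass o (pullbackBilin (𝓡∂ 3) (𝓡 4) j X.g) b ν
        (fun s => spatial (φ (j (b s)))) n₀ := by
  exact corollary1p2_general X (fun s => (hj.contMDiff _).of_le ENat.LEInfty.out)
    (fun s => hΩ (b s)) (hb.contMDiff.of_le ENat.LEInfty.out) hb.injective_dmap hν hNnormal ho
    (fun s => (hφ.toIsReference.contMDiffAt ⟨s, rfl⟩).of_le ENat.LEInfty.out)
    (fun s => hφ.isometric _ ⟨s, rfl⟩) hφN hn₀ hout
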